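/- Let $\Bbbk$ be a commutative domain of prime characteristic $p$, and let $X$ be a commutative unital $\Bbbk$-algebra that is free of finite rank as a $\Bbbk$-module. Let $L$ be a restricted Lie algebra over $\Bbbk$ with $p$-mapping $a\mapsto a^{[p]}$, and let $U(L)=T(L)/\langle a\otimes b-b\otimes a-[a,b],\ a^{\otimes p}-a^{[p]}\rangle$ be its (restricted) universal enveloping algebra. Assume that $L$ is self-similar with alphabet $X$: it is endowed with a Lie algebra homomorphism $\psi:L\to (X\otimes L)\rtimes\operatorname{Der}X$, where derivations act on the first coordinate, which preserves the $p$-mapping; the $p$-mapping on the right is the one with $(x\otimes a)^{[p]}=x^p\otimes a^{[p]}$ and $\delta^{[p]}=\delta^p$. Assume that $L$ is faithful: no non-zero element of $L$ acts as zero in the action of $L$ on the tensor algebra $T(X)$ given by $a\cdot 1=0$ and $a\cdot(x_1\otimes\cdots\otimes x_n)=\sum x_1y_i\otimes(a_i\cdot x_2\otimes\cdots\otimes x_n)+(\delta x_1)\otimes x_2\otimes\cdots\otimes x_n$ if $\psi(a)=\sum y_i\otimes a_i+\delta$. Let $\lambda,\mu\in\mathbb R$ with $\lambda>|\mu|>1$.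 Assume that $L$ has two gradings by real numbers, with degree functions $\deg_\lambda$ and $\deg_\mu$, of dilations $\lambda$ and $\mu$ respectively. This means, for $\nu\in\{\lambda,\mu\}$: $X$ and $L$ are $\mathbb R$-graded as an algebra and as a Lie algebra, $\deg_\nu(a^{[p]})=p\deg_\nu(a)$ for homogeneous $a\in L$, and $\psi$ preserves degrees when $y\otimes b$ is given degree $\deg_\nu(y)+\nu\deg_\nu(b)$ and a derivation $\delta$ of $X$ has degree $d$ if it raises degrees by $d$. Assume that $L$ is generated, as a restricted Lie algebra, by finitely many elements that are homogeneous of positive degree with respect to $\deg_\lambda$. Extend $\deg_\mu$ to $U(L)$ by $\deg_\mu(a_1\cdots a_n)=\sum_i\deg_\mu(a_i)$ for homogeneous $a_i\in L$, and let $U_+$, $U_0$, $U_-$ be the spans of the homogeneous elements $u\in U(L)$ with $\deg_\mu(u)>0$, $=0$, $<0$ respectively. Then $U_+,U_0,U_-$ are subalgebras (with $1\in U_0$), \[U(L)=U_+\oplus U_0\oplus U_-,\] and $U_+$ and $U_-$ are locally nilpotent: each finite subset generates a nilpotent (non-unital) subalgebra. In particular, every homogeneous element $u\in U(L)$ with $\deg_\mu(u)\ne0$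 is nilpotent. -/

import Mathlib

open scoped TensorProduct

noncomputable section

namespace SelfSimilarLie

/-! ### Restricted Lie algebras -/

section Restricted

variable {L : Type*} [LieRing L]

/-- The Lie polynomial in Jacobson's formula `(x + y)^[p] = x^[p] + y^[p] + ∑ i, s_i(x, y)`, where
`i * s_i(x, y)` is the coefficient of `t ^ (i - 1)` in `ad(t x + y) ^ (p - 1) (x)`.
The coefficient is expanded as a sum over the words `w` in the letters `x` (`true`) and `y`
(`false`) of length `p - 1`; a word with `i - 1` letters `x` is weighted by the inverse of `i`
modulo `p`. (The only word with `i = p` contributes `ad(x) ^ (p - 1) (x) = 0`.) -/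
def jacobsonSum (p : ℕ) (x y : L) : L :=
  ∑ w : Fin (p - 1) → Bool,
    ((((Finset.univ.filter fun j => w j = true).card + 1 : ℕ) : ZMod p)⁻¹).val •
      (List.ofFn w).foldr (fun b z => ⁅if b then x else y, z⁆) x

variable (k : Type*) [CommRing k] [LieAlgebra k L]

/-- `f` is a `p`-mapping `x ↦ x^[p]` on the Lie algebra `L` over `k` (of characteristic `p`),
so that `(L, f)` is a restricted Lie algebra. -/
structure IsPMap (p : ℕ) (f : L → L) : Prop where
  smul : ∀ (c : k) (x : L), f (c • x) = c ^ p • f x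
  lie : ∀ x y : L, ⁅f x, y⁆ = (fun z => ⁅x, z⁆)^[p] y
  add : ∀ x y : L, f (x + y) = f x + f y + jacobsonSum p x y

end Restricted

/-! ### Restricted enveloping algebras -/

section Enveloping

variable (k : Type*) {L : Type*} [CommRing k] [LieRing L] [LieAlgebra k L]

/-- The relations `a b - b a = [a, b]` and `a ^ p = a^[p]` on the tensor algebra of `L`. -/
inductive EnvelopingRel (p : ℕ) (f : L → L) : TensorAlgebra k L → TensorAlgebra k L → Prop
  | lie (a b : L) : EnvelopingRel p f
      (TensorAlgebra.ι k a * TensorAlgebra.ι k b - TensorAlgebra.ι k b * TensorAlgebra.ι k a)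
      (TensorAlgebra.ι k ⁅a, b⁆)
  | pow (a : L) : EnvelopingRel p f (TensorAlgebra.ι k a ^ p) (TensorAlgebra.ι k (f a))

/-- The (restricted) universal enveloping algebra `U(L)` of the restricted Lie algebra `(L, f)`. -/
def Enveloping (p : ℕ) (f : L → L) : Type _ := RingQuot (EnvelopingRel k p f)

instance (p : ℕ) (f : L → L) : Ring (Enveloping k p f) :=
  inferInstanceAs (Ring (RingQuot (EnvelopingRel k p f)))

instance (p : ℕ) (f : L → L) : Algebra k (Enveloping k p f) :=
  inferInstanceAs (Algebra k (RingQuot (EnvelopingRel k p f)))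

/-- The canonical map `L → U(L)`. -/
def Enveloping.ι (p : ℕ) (f : L → L) : L →ₗ[k] Enveloping k p f :=
  (RingQuot.mkAlgHom k (EnvelopingRel k p f)).toLinearMap ∘ₗ TensorAlgebra.ι k

/-- The homogeneous elements of degree `d` of `U(L)`, for the grading induced by a grading `ℒ`
of `L`: the span of all products `a₁ ⋯ aₙ` of homogeneous elements of `L` whose degrees have
sum `d`. -/
def Enveloping.homogeneous (p : ℕ) (f : L → L) (ℒ : ℝ → Submodule k L) (d : ℝ) :
    Submodule k (Enveloping k p f) :=
  Submodule.span k {u | ∃ l : List (ℝ × L), (∀ q ∈ l, q.2 ∈ ℒ q.1) ∧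
    (l.map Prod.fst).sum = d ∧ u = (l.map fun q => Enveloping.ι k p f q.2).prod}

/-- The span of the homogeneous elements of `U(L)` whose degree has sign `s`: these are
`U₊`, `U₀`, `U₋` for `s = 1`, `0`, `-1`. -/
def Enveloping.signPart (p : ℕ) (f : L → L) (ℒ : ℝ → Submodule k L) (s : SignType) :
    Submodule k (Enveloping k p f) :=
  ⨆ (d : ℝ) (_ : SignType.sign d = s), Enveloping.homogeneous k p f ℒ d

/-- A subset of an associative algebra is locally nilpotent if each finite subset of it generates
a nilpotent (non-unital) subalgebra `B`, that is, `B ^ n = 0` for some `n`. -/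
def IsLocallyNilpotent {A : Type*} [Ring A] [Algebra k A] (V : Set A) : Prop :=
  ∀ F : Finset A, (F : Set A) ⊆ V → ∃ n : ℕ, ∀ l : List A, l.length = n →
    (∀ x ∈ l, x ∈ NonUnitalAlgebra.adjoin k (F : Set A)) → l.prod = 0

end Enveloping

/-! ### Wreath products and self-similar Lie algebras -/

section Wreath

variable (k X L : Type*) [CommRing k] [CommRing X] [Algebra k X] [LieRing L] [LieAlgebra k L]

/-- The derivations of `X` act on the Lie algebra `X ⊗ L` by deriving the first coordinate. -/
def derAction : Derivation k X X →ₗ⁅k⁆ LieDerivation k (X ⊗[k] L) (X ⊗[k] L) where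
  toFun δ :=
    { toLinearMap := LinearMap.rTensor L (δ : X →ₗ[k] X)
      leibniz' := fun v w => by
        induction v using TensorProduct.induction_on with
        | zero => simp
        | add v v' hv hv' => simp only [add_lie, map_add, lie_add, hv, hv']; abel
        | tmul x a =>
          induction w using TensorProduct.induction_on with
          | zero => simp
          | add w w' hw hw' => simp only [add_lie, map_add, lie_add, hw, hw']; abel
          | tmul y b =>
            simp only [LieAlgebra.ExtendScalars.bracket_tmul, LinearMap.rTensor_tmul,
              Derivation.coeFn_coe, Derivation.leibniz, smul_eq_mul, TensorProduct.add_tmul]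
            rw [← lie_skew a b, TensorProduct.tmul_neg]
            simp only [TensorProduct.tmul_neg]
            abel }
  map_add' δ ε := by
    ext v
    exact congrArg (fun g : X ⊗[k] L →ₗ[k] X ⊗[k] L => g v)
      (LinearMap.rTensor_add L (δ : X →ₗ[k] X) (ε : X →ₗ[k] X))
  map_smul' c δ := by
    ext v
    exact congrArg (fun g : X ⊗[k] L →ₗ[k] X ⊗[k] L => g v)
      (LinearMap.rTensor_smul L c (δ : X →ₗ[k] X))
  map_lie' := by
    intro δ ε
    ext v
    induction v using TensorProduct.induction_on with
    | zero => simp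
    | add v w hv hw => rw [map_add, map_add, hv, hw]
    | tmul x a =>
      simp only [LieDerivation.lie_apply, LieDerivation.mk_coe, LinearMap.rTensor_tmul,
        Derivation.coeFn_coe, Derivation.commutator_apply, TensorProduct.sub_tmul]

/-- The wreath product `L ≀ Der X = (X ⊗ L) ⋊ Der X`. -/
abbrev Wreath : Type _ :=
  LieAlgebra.SemiDirectSum (X ⊗[k] L) (Derivation k X X) (derAction k X L)

variable {k X L}

/-- `P` is the `p`-mapping of the wreath product `L ≀ Der X`, where `f` is the `p`-mapping of `L`:
it is given by `(x ⊗ a)^[p] = x ^ p ⊗ a^[p]` on `X ⊗ L` and by `δ^[p] = δ ∘ ⋯ ∘ δ` on `Der X`. -/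
structure IsWreathPMap (p : ℕ) (f : L → L) (P : Wreath k X L → Wreath k X L) : Prop where
  isPMap : IsPMap k p P
  tmul : ∀ (x : X) (a : L), P ⟨x ⊗ₜ[k] a, 0⟩ = ⟨(x ^ p) ⊗ₜ[k] f a, 0⟩
  der_left : ∀ δ : Derivation k X X, (P ⟨0, δ⟩).left = 0
  der_right : ∀ (δ : Derivation k X X) (x : X), (P ⟨0, δ⟩).right x = δ^[p] x

/-- The self-similarity structure `ψ` preserves the `p`-mapping. -/
def PreservesPMap (p : ℕ) (f : L → L) (ψ : L →ₗ⁅k⁆ Wreath k X L) : Prop :=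
  ∃ P : Wreath k X L → Wreath k X L, IsWreathPMap p f P ∧ ∀ a : L, ψ (f a) = P (ψ a)

/-- The natural action of `a : L` on the elementary tensor `x₁ ⊗ ⋯ ⊗ xₙ` of `T(X)`, given as the
list `[x₁, …, xₙ]`: it is `0` for `n = 0`, and otherwise
`∑ x₁ yᵢ ⊗ (aᵢ · x₂ ⊗ ⋯ ⊗ xₙ) + (δ x₁) ⊗ x₂ ⊗ ⋯ ⊗ xₙ` if `ψ a = ∑ yᵢ ⊗ aᵢ + δ`. -/
def naturalAction (ψ : L →ₗ⁅k⁆ Wreath k X L) : List X → L →ₗ[k] TensorAlgebra k X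
  | [] => 0
  | x :: w =>
    (LinearMap.mul' k (TensorAlgebra k X) ∘ₗ
        TensorProduct.map (TensorAlgebra.ι k ∘ₗ LinearMap.mulLeft k x) (naturalAction ψ w) ∘ₗ
        LieAlgebra.SemiDirectSum.projl (derAction k X L) ∘ₗ (ψ : L →ₗ[k] Wreath k X L)) +
      { toFun := fun a =>
          TensorAlgebra.ι k ((ψ a).right x) * (w.map (TensorAlgebra.ι k)).prod
        map_add' := fun a b => by simp [add_mul]
        map_smul' := fun c a => by simp }

/-- The self-similar Lie algebra `(L, ψ)` is faithful: only `0` acts as zero on `T(X)`. (The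
elementary tensors span `T(X)`.) -/
def IsFaithful (ψ : L →ₗ⁅k⁆ Wreath k X L) : Prop :=
  ∀ a : L, (∀ w : List X, naturalAction ψ w a = 0) → a = 0

/-- The elements of degree `d` of the wreath product, for gradings `𝒳` of `X` and `ℒ` of `L` and
the dilation `dil`: the `X ⊗ L` component is a sum of tensors `y ⊗ a` with
`deg y + dil * deg a = d`, and the `Der X` component is a derivation of degree `d`. -/
def wreathDegree (dil : ℝ) (𝒳 : ℝ → Submodule k X) (ℒ : ℝ → Submodule k L) (d : ℝ) :
    Set (Wreath k X L) :=
  {v | v.left ∈ Submodule.span k {t : X ⊗[k] L | ∃ (e f : ℝ) (y : X) (a : L),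
      y ∈ 𝒳 e ∧ a ∈ ℒ f ∧ e + dil * f = d ∧ t = y ⊗ₜ[k] a} ∧
    ∀ (e : ℝ) (x : X), x ∈ 𝒳 e → v.right x ∈ 𝒳 (d + e)}

/-- `𝒳` and `ℒ` are gradings of the alphabet `X` and of the restricted Lie algebra `(L, f)` by real
degrees, and they are compatible with the self-similarity structure `ψ` for the dilation `dil`. -/
structure IsSelfSimilarGrading (p : ℕ) (f : L → L) (ψ : L →ₗ⁅k⁆ Wreath k X L) (dil : ℝ)
    (𝒳 : ℝ → Submodule k X) (ℒ : ℝ → Submodule k L) : Prop where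
  alphabet_isInternal : DirectSum.IsInternal 𝒳
  alphabet_graded : SetLike.GradedMonoid 𝒳
  isInternal : DirectSum.IsInternal ℒ
  lie_mem : ∀ (d e : ℝ) (a b : L), a ∈ ℒ d → b ∈ ℒ e → ⁅a, b⁆ ∈ ℒ (d + e)
  pMap_mem : ∀ (d : ℝ) (a : L), a ∈ ℒ d → f a ∈ ℒ (p * d)
  compatible : ∀ (d : ℝ) (a : L), a ∈ ℒ d → ψ a ∈ wreathDegree dil 𝒳 ℒ d

end Wreath

/-- `S` generates the restricted Lie algebra `(L, f)`: the only Lie subalgebra that contains `S`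
and is closed under the `p`-mapping is `L` itself. -/
def GeneratesRestricted (k : Type*) {L : Type*} [CommRing k] [LieRing L] [LieAlgebra k L]
    (f : L → L) (S : Set L) : Prop :=
  ∀ M : LieSubalgebra k L, S ⊆ (M : Set L) → (∀ a ∈ M, f a ∈ M) → M = ⊤

end SelfSimilarLie

/-!
For every `ε > 0` the `mu`-degrees that occur in the `lam`-degree `d` component of `L` are at most
`ε * d` in absolute value once `d` is large: as `ψ` is injective and the degrees of `X` are bounded,
applying `ψ` divides the `lam`-degree by `lam` and the `mu`-degree by `mu`, up to bounded errors, so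
that the `mu`-degree grows like `d ^ (log |mu| / log lam)`. Straightening products of homogeneous
elements of `L` into products of powers `b ^ j` with `j < p`, in the order of increasing degree of
`b`, transfers this to `U(L)`: the component of `lam`-degree `m` lies in `mu`-degrees of absolute
value at most `C + ε * m`. A product of `n` elements of a finite subset of `U_+` has `lam`-degree
`O(n)` but `mu`-degree at least `η * n` for some `η > 0`, so it vanishes for large `n`.

The components of `U(L)` are independent because the coaction `a ↦ single (deg a) a` of `L` extends
to an algebra homomorphism from `U(L)` to its monoid algebra over `ℝ`; that it respects the
`p`-mapping on non-homogeneous elements is Jacobson's formula.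
-/

noncomputable section

namespace SelfSimilarLie

/-! ### Jacobson's formula -/

section Jacobson

open Polynomial Finset

/-- The iterated bracket `⁅u₁, ⁅u₂, … ⁅uₙ, c⁆ …⁆⁆` where `uᵢ` is `x` or `y` according to whether
the `i`-th letter of `l` is `true` or `false`: the summands of `jacobsonSum`. -/
def lieWord {L : Type*} [LieRing L] (x y : L) (l : List Bool) (c : L) : L :=
  l.foldr (fun b z => ⁅if b then x else y, z⁆) c

section LieRing

variable {L : Type*} [LieRing L]

theorem jacobsonSum_eq_sum_lieWord (p : ℕ) (x y : L) :
    jacobsonSum p x y = ∑ w : Fin (p - 1) → Bool,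
      (((#{j | w j = true} + 1 : ℕ) : ZMod p)⁻¹).val • lieWord x y (List.ofFn w) x :=
  rfl

@[simp]
theorem lieWord_cons (x y c : L) (b : Bool) (l : List Bool) :
    lieWord x y (b :: l) c = ⁅if b then x else y, lieWord x y l c⁆ :=
  rfl

theorem map_jacobsonSum {M : Type*} [LieRing M] (g : L →+ M)
    (hg : ∀ a b, g ⁅a, b⁆ = ⁅g a, g b⁆) (p : ℕ) (x y : L) :
    g (jacobsonSum p x y) = jacobsonSum p (g x) (g y) := by
  have map_lieWord (l : List Bool) : g (lieWord x y l x) = lieWord (g x) (g y) l (g x) := by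
    induction l with
    | nil => rfl
    | cons b l ih => rw [lieWord_cons, hg, ih, lieWord_cons, apply_ite g]
  simp only [jacobsonSum_eq_sum_lieWord, map_sum, map_nsmul, map_lieWord]

theorem jacobsonSum_mem {S : Type*} [SetLike S L] [AddSubmonoidClass S L] {V : S}
    (hV : ∀ a b, a ∈ V → b ∈ V → ⁅a, b⁆ ∈ V) (p : ℕ) {x y : L} (hx : x ∈ V) (hy : y ∈ V) :
    jacobsonSum p x y ∈ V := by
  have lieWord_mem (l : List Bool) : lieWord x y l x ∈ V := by
    induction l with
    | nil => exact hx
    | cons b l ih =>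
      cases b
      · exact hV _ _ hy ih
      · exact hV _ _ hx ih
  exact sum_mem fun w _ => nsmul_mem (lieWord_mem _) _

end LieRing

attribute [local instance] LieRing.ofAssociativeRing

variable {A : Type*} [Ring A]

theorem derivative_pow_eq_sum (q : A[X]) (n : ℕ) :
    derivative (q ^ n) = ∑ i ∈ range n, q ^ i * derivative q * q ^ (n - 1 - i) := by
  induction n with
  | zero => simp
  | succ n ih =>
    rw [pow_succ, derivative_mul, ih, sum_range_succ, sum_mul]
    congr 1
    · refine sum_congr rfl fun i hi => ?_
      rw [mul_assoc, ← pow_succ]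
      congr 2
      have := mem_range.mp hi
      omega
    · simp

variable {p : ℕ}

theorem neg_one_pow_mul_choose_prime_sub_one (hp : p.Prime) (h0 : (p : A) = 0) {i : ℕ}
    (hi : i < p) : (-1 : A) ^ i * ((p - 1).choose i : A) = 1 := by
  induction i with
  | zero => simp
  | succ i ih =>
    have pascal : (p - 1).choose i + (p - 1).choose (i + 1) = p.choose (i + 1) := by
      rw [← Nat.choose_succ_succ', Nat.sub_add_cancel hp.one_le]
    obtain ⟨c, hc⟩ := hp.dvd_choose_self (Nat.succ_ne_zero i) hi
    have sum_eq_zero : ((p - 1).choose i : A) + ((p - 1).choose (i + 1) : A) = 0 := by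
      rw [← Nat.cast_add, pascal, hc, Nat.cast_mul, h0, zero_mul]
    rw [pow_succ, eq_neg_of_add_eq_zero_right sum_eq_zero, mul_assoc, neg_one_mul, neg_neg,
      ih (by omega)]

theorem iterate_lie_prime_sub_one (hp : p.Prime) (h0 : (p : A) = 0) (z w : A) :
    (fun u => ⁅z, u⁆)^[p - 1] w = ∑ i ∈ range p, z ^ i * w * z ^ (p - 1 - i) := by
  have lie_eq : (fun u => ⁅z, u⁆) = ⇑(LinearMap.mulLeft ℤ z + -LinearMap.mulRight ℤ z) := by
    ext u
    simp [Ring.lie_def, sub_eq_add_neg]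
  have left_right_commute : Commute (LinearMap.mulLeft ℤ z) (-LinearMap.mulRight ℤ z) :=
    (LinearMap.commute_mulLeft_right z z (R := ℤ)).neg_right
  have neg_one_pow_apply (n : ℕ) (v : A) : ((-1 : Module.End ℤ A) ^ n) v = (-1) ^ n * v := by
    rcases n.even_or_odd with h | h <;> simp [h.neg_one_pow]
  rw [lie_eq, ← Module.End.coe_pow, left_right_commute.add_pow, Nat.sub_add_cancel hp.one_le,
    LinearMap.sum_apply]
  refine sum_congr rfl fun i hi => ?_
  have hi := mem_range.mp hi
  have sign_mul_choose := neg_one_pow_mul_choose_prime_sub_one hp h0 (i := p - 1 - i) (by omega)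
  rw [Nat.choose_symm (by omega : i ≤ p - 1)] at sign_mul_choose
  rw [neg_pow, LinearMap.pow_mulRight, LinearMap.pow_mulLeft]
  simp only [Module.End.mul_apply, Module.End.natCast_apply, neg_one_pow_apply, nsmul_eq_mul,
    LinearMap.mulRight_apply, LinearMap.mulLeft_apply, mul_assoc]
  rw [← mul_assoc ((-1 : A) ^ _), sign_mul_choose, one_mul]

theorem lie_monomial_add_C (x y c : A) (m : ℕ) :
    ⁅monomial 1 x + C y, monomial m c⁆ = monomial (m + 1) ⁅x, c⁆ + monomial m ⁅y, c⁆ := by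
  simp only [Ring.lie_def, ← monomial_zero_left, add_mul, mul_add, monomial_mul_monomial,
    add_zero, zero_add, map_sub, add_comm 1 m]
  abel

theorem iterate_lie_monomial_add_C (x y c : A) (n : ℕ) :
    (fun u => ⁅monomial 1 x + C y, u⁆)^[n] (C c) = ∑ w : Fin n → Bool,
      monomial #{j | w j = true} (lieWord x y (List.ofFn w) c) := by
  induction n with
  | zero => simp [lieWord]
  | succ n ih =>
    have sum_cons (F : (Fin (n + 1) → Bool) → A[X]) :
        ∑ w, F w = ∑ w : Fin n → Bool, (F (Fin.cons true w) + F (Fin.cons false w)) := by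
      rw [← (Fin.consEquiv fun _ => Bool).sum_comp, Fintype.sum_prod_type, Finset.sum_comm]
      simp [Fin.consEquiv]
    have card_cons (b : Bool) (w : Fin n → Bool) :
        #{j | (Fin.cons b w : Fin (n + 1) → Bool) j = true} =
          #{j | w j = true} + if b then 1 else 0 := by
      rw [Fin.card_filter_univ_succ]
      cases b <;> simp
    rw [Function.iterate_succ_apply', ih, lie_sum, sum_cons]
    refine sum_congr rfl fun w _ => ?_
    simp only [lie_monomial_add_C, card_cons, List.ofFn_succ, Fin.cons_zero, Fin.cons_succ,
      lieWord_cons, if_true, Bool.false_eq_true, if_false, add_zero]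

variable (x y : A)

theorem add_pow_eq_sum_coeff (n : ℕ) :
    (x + y) ^ n = ∑ i ∈ range (n + 1), ((monomial 1 x + C y) ^ n).coeff i := by
  let evalOne : A[X] →+* A := eval₂RingHom' (RingHom.id A) 1 Commute.one_right
  have evalOne_eq : evalOne (monomial 1 x + C y) = x + y := by
    simp [evalOne, eval₂RingHom', ← C_mul_X_eq_monomial]
  have natDegree_lt : ((monomial 1 x + C y) ^ n).natDegree < n + 1 := by
    have := natDegree_pow_le_of_le n (natDegree_linear_le (a := x) (b := y))
    rw [C_mul_X_eq_monomial] at this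
    omega
  rw [← evalOne_eq, ← map_pow]
  exact (eval₂_eq_sum_range' (RingHom.id A) natDegree_lt 1).trans (by simp)

theorem coeff_succ_pow_mul_succ (hp : p.Prime) (h0 : (p : A) = 0) (i : ℕ) :
    ((monomial 1 x + C y) ^ p).coeff (i + 1) * (i + 1) =
      ∑ w : Fin (p - 1) → Bool,
        if #{j | w j = true} = i then lieWord x y (List.ofFn w) x else 0 := by
  have h0' : (p : A[X]) = 0 := by rw [← C_eq_natCast, h0, C_0]
  have derivative_eq : derivative (monomial 1 x + C y) = C x := by simp
  rw [← coeff_derivative, derivative_pow_eq_sum, derivative_eq,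
    ← iterate_lie_prime_sub_one hp h0', iterate_lie_monomial_add_C, finsetSum_coeff]
  simp only [coeff_monomial]

theorem val_inv_mul_natCast [Fact p.Prime] (h0 : (p : A) = 0) {n : ℕ} (hn : (n : ZMod p) ≠ 0) :
    ((n : ZMod p)⁻¹.val : A) * n = 1 := by
  have modEq : (n : ZMod p)⁻¹.val * n ≡ 1 [MOD p] := by
    rw [← ZMod.natCast_eq_natCast_iff, Nat.cast_mul, ZMod.natCast_zmod_val, inv_mul_cancel₀ hn,
      Nat.cast_one]
  have cast_mod (m : ℕ) : ((m % p : ℕ) : A) = m := by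
    conv_rhs => rw [← Nat.mod_add_div m p, Nat.cast_add, Nat.cast_mul, h0, zero_mul, add_zero]
  rw [← Nat.cast_mul, ← cast_mod, modEq, cast_mod, Nat.cast_one]

theorem coeff_succ_pow_eq_sum [hp : Fact p.Prime] (h0 : (p : A) = 0) {i : ℕ} (hi : i + 1 < p) :
    ((monomial 1 x + C y) ^ p).coeff (i + 1) =
      ∑ w : Fin (p - 1) → Bool, if #{j | w j = true} = i then
        (((#{j | w j = true} + 1 : ℕ) : ZMod p)⁻¹).val • lieWord x y (List.ofFn w) x else 0 := by
  have succ_ne_zero : ((i + 1 : ℕ) : ZMod p) ≠ 0 := by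
    rw [Ne, ZMod.natCast_eq_zero_iff]
    exact Nat.not_dvd_of_pos_of_lt i.succ_pos hi
  calc ((monomial 1 x + C y) ^ p).coeff (i + 1)
    _ = ((i + 1 : ℕ) : ZMod p)⁻¹.val • (((monomial 1 x + C y) ^ p).coeff (i + 1) * (i + 1)) := by
      rw [nsmul_eq_mul, ← Nat.cast_add_one, ← Nat.cast_comm, ← mul_assoc,
        val_inv_mul_natCast h0 succ_ne_zero, one_mul]
    _ = _ := by
      rw [coeff_succ_pow_mul_succ x y hp.out h0, smul_sum]
      refine sum_congr rfl fun w _ => ?_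
      split_ifs with h
      · rw [h]
      · exact smul_zero _

theorem jacobsonSum_eq_sum_coeff [hp : Fact p.Prime] (h0 : (p : A) = 0) :
    jacobsonSum p x y =
      ∑ i ∈ range (p - 1), ((monomial 1 x + C y) ^ p).coeff (i + 1) := by
  rw [sum_congr rfl fun i hi =>
    coeff_succ_pow_eq_sum x y h0 (Nat.lt_sub_iff_add_lt.mp (mem_range.mp hi)), sum_comm,
    jacobsonSum_eq_sum_lieWord]
  refine sum_congr rfl fun w _ => ?_
  rw [sum_ite_eq]
  split_ifs with h
  · rfl
  · have card_le : #{j | w j = true} ≤ p - 1 := (card_filter_le _ _).trans (by simp)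
    have card_eq : #{j | w j = true} + 1 = p := by
      have := hp.out.one_le
      rw [mem_range] at h
      omega
    -- the word `x ⋯ x` has weight `0⁻¹ = 0`
    simp [card_eq]

theorem add_pow_eq_jacobsonSum [hp : Fact p.Prime] (h0 : (p : A) = 0) :
    (x + y) ^ p = x ^ p + y ^ p + jacobsonSum p x y := by
  have coeff_zero : ((monomial 1 x + C y) ^ p).coeff 0 = y ^ p := by
    simpa using map_pow constantCoeff (monomial 1 x + C y) p
  have coeff_top : ((monomial 1 x + C y) ^ p).coeff p = x ^ p := by
    have natDegree_le : (monomial 1 x + C y).natDegree ≤ 1 := by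
      simpa only [C_mul_X_eq_monomial] using natDegree_linear_le (a := x) (b := y)
    simpa [coeff_C] using coeff_pow_of_natDegree_le natDegree_le (m := p)
  obtain ⟨q, rfl⟩ : ∃ q, p = q + 1 := ⟨p - 1, (Nat.sub_add_cancel hp.out.one_le).symm⟩
  rw [add_pow_eq_sum_coeff, sum_range_succ, coeff_top, sum_range_succ', coeff_zero,
    jacobsonSum_eq_sum_coeff x y h0, Nat.add_sub_cancel]
  abel

end Jacobson

/-! ### Graded parts -/

section GradedPart

variable {ι k M : Type*} [CommRing k] [AddCommGroup M] [Module k M]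

/-- The sum of the components of a family of submodules whose index lies in `T`; the family is
usually a grading. -/
def gradedPart (V : ι → Submodule k M) (T : Set ι) : Submodule k M :=
  ⨆ d ∈ T, V d

variable {V : ι → Submodule k M} {T T' : Set ι} {d : ι} {v : M}

theorem mem_gradedPart_of_mem (hd : d ∈ T) (hv : v ∈ V d) : v ∈ gradedPart V T :=
  Submodule.mem_iSup_of_mem d (Submodule.mem_iSup_of_mem hd hv)

theorem gradedPart_le {W : Submodule k M} : gradedPart V T ≤ W ↔ ∀ d ∈ T, V d ≤ W :=
  iSup₂_le_iff

theorem gradedPart_mono (h : T ⊆ T') : gradedPart V T ≤ gradedPart V T' :=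
  biSup_mono h

theorem disjoint_gradedPart (hV : iSupIndep V) (h : Disjoint T T') :
    Disjoint (gradedPart V T) (gradedPart V T') :=
  hV.disjoint_biSup_biSup h

theorem isInternal_gradedPart_preimage {κ : Type*} [DecidableEq ι] [DecidableEq κ]
    (hV : DirectSum.IsInternal V) (g : ι → κ) :
    DirectSum.IsInternal fun s => gradedPart V (g ⁻¹' {s}) := by
  rw [DirectSum.isInternal_submodule_iff_iSupIndep_and_iSup_eq_top]
  refine ⟨fun s => ?_, eq_top_iff.2 (hV.submodule_iSup_eq_top ▸ iSup_le fun d v hv => ?_)⟩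
  · refine (disjoint_gradedPart hV.submodule_iSupIndep disjoint_compl_right).mono_right
      (iSup₂_le fun t ht => gradedPart_mono fun d hd => ?_)
    exact fun hs => ht (hd.symm.trans hs)
  · exact Submodule.mem_iSup_of_mem (g d) (mem_gradedPart_of_mem rfl hv)

theorem iSupIndep_of_apply_eq_single (Φ : M →ₗ[k] ι →₀ M)
    (hΦ : ∀ d, ∀ v ∈ V d, Φ v = Finsupp.single d v) : iSupIndep V := by
  refine iSupIndep_def.2 fun d => Submodule.disjoint_def.2 fun v hv hv' => ?_
  have apply_eq_zero : (⨆ j ≠ d, V j) ≤ LinearMap.ker (Finsupp.lapply d ∘ₗ Φ) :=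
    iSup₂_le fun j hj w hw => by simp [hΦ j w hw, Finsupp.single_eq_of_ne hj.symm]
  simpa [hΦ d v hv] using apply_eq_zero hv'

theorem exists_apply_eq_single [DecidableEq ι] (hV : DirectSum.IsInternal V) :
    ∃ Φ : M →ₗ[k] ι →₀ M, ∀ d, ∀ v ∈ V d, Φ v = Finsupp.single d v := by
  let _ := hV.chooseDecomposition
  refine ⟨DirectSum.toModule k ι _ (fun d => Finsupp.lsingle d ∘ₗ (V d).subtype) ∘ₗ
    (DirectSum.decomposeLinearEquiv V).toLinearMap, fun d v hv => ?_⟩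
  simp only [LinearMap.comp_apply, LinearEquiv.coe_coe, DirectSum.decomposeLinearEquiv_apply,
    DirectSum.decompose_of_mem V hv]
  exact DirectSum.toModule_lof k d _

theorem mem_gradedPart_of_map_mem {N : Type*} [AddCommGroup N] [Module k N]
    {W : ι → Submodule k N} (hV : ⨆ d, V d = ⊤) (hW : iSupIndep W) {g : M →ₗ[k] N}
    (hg : ∀ d, ∀ v ∈ V d, g v ∈ W d) (hinj : ∀ d ∉ T, ∀ v ∈ V d, g v = 0 → v = 0)
    (hv : g v ∈ gradedPart W T) : v ∈ gradedPart V T := by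
  classical
  obtain ⟨c, hc, rfl⟩ : ∃ c : ι →₀ M, (∀ d, c d ∈ V d) ∧ (c.sum fun _ w => w) = v :=
    (Submodule.mem_iSup_iff_exists_finsupp V v).1 (hV ▸ Submodule.mem_top)
  refine sum_mem fun d hd => ?_
  by_cases hdT : d ∈ T
  · exact mem_gradedPart_of_mem hdT (hc d)
  have sum_erase_mem : ∑ e ∈ c.support.erase d, g (c e) ∈ gradedPart W {d}ᶜ :=
    sum_mem fun e he => mem_gradedPart_of_mem (Finset.ne_of_mem_erase he) (hg e _ (hc e))
  have map_mem : g (c d) ∈ gradedPart W {d}ᶜ := by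
    have := gradedPart_mono (Set.subset_compl_singleton_iff.2 hdT) hv
    rwa [Finsupp.sum, map_sum, ← Finset.add_sum_erase _ _ hd,
      Submodule.add_mem_iff_left _ sum_erase_mem] at this
  have map_eq_zero := Submodule.disjoint_def.1 (disjoint_gradedPart hW disjoint_compl_right)
    _ (mem_gradedPart_of_mem (Set.mem_singleton d) (hg d _ (hc d))) map_mem
  rw [hinj d hdT _ (hc d) map_eq_zero]
  exact zero_mem _

theorem finite_setOf_ne_bot [Module.Finite k M] (hV : iSupIndep V) (htop : ⨆ d, V d = ⊤) :
    {d | V d ≠ ⊥}.Finite := by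
  have isCompactElement_top : IsCompactElement (⊤ : Submodule k M) :=
    (Submodule.fg_iff_compact _).1 Module.Finite.fg_top
  obtain ⟨s, hs⟩ :=
    CompleteLattice.IsCompactElement.exists_finset_of_le_iSup _ isCompactElement_top V htop.ge
  refine s.finite_toSet.subset fun d hd => by_contra fun hds => hd ?_
  have disjoint_iSup : Disjoint (V d) (⨆ e ∈ s, V e) :=
    (hV d).mono_right (biSup_mono fun e he => by rintro rfl; exact hds he)
  rwa [top_le_iff.1 hs, disjoint_top] at disjoint_iSup

end GradedPart

section BoundedPart

variable {k M : Type*} [CommRing k] [AddCommGroup M] [Module k M]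

/-- The sum of the components of degree at most `r` in absolute value of a grading by the real
numbers. -/
def boundedPart (V : ℝ → Submodule k M) (r : ℝ) : Submodule k M :=
  gradedPart V {d | |d| ≤ r}

variable {V : ℝ → Submodule k M}

theorem mem_boundedPart_of_mem {r d : ℝ} (hd : |d| ≤ r) {v : M} (hv : v ∈ V d) :
    v ∈ boundedPart V r :=
  mem_gradedPart_of_mem (T := {d | |d| ≤ r}) hd hv

theorem boundedPart_le {r : ℝ} {W : Submodule k M} :
    boundedPart V r ≤ W ↔ ∀ d, |d| ≤ r → V d ≤ W :=
  gradedPart_le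

theorem boundedPart_mono {r s : ℝ} (h : r ≤ s) : boundedPart V r ≤ boundedPart V s :=
  boundedPart_le.2 fun _ hd _ hv => mem_boundedPart_of_mem (hd.trans h) hv

theorem exists_subset_boundedPart (hV : ⨆ d, V d = ⊤) {s : Set M} (hs : s.Finite) :
    ∃ r, 0 ≤ r ∧ s ⊆ boundedPart V r := by
  have exists_mem (v : M) : ∃ r, v ∈ boundedPart V r := by
    refine Submodule.iSup_induction V (motive := fun v => ∃ r, v ∈ boundedPart V r)
      (hV ▸ Submodule.mem_top) (fun d w hw => ⟨|d|, mem_boundedPart_of_mem le_rfl hw⟩)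
      ⟨0, zero_mem _⟩ ?_
    rintro v w ⟨r, hr⟩ ⟨t, ht⟩
    exact ⟨max r t, add_mem (boundedPart_mono (le_max_left _ _) hr)
      (boundedPart_mono (le_max_right _ _) ht)⟩
  choose bound mem_bound using exists_mem
  obtain ⟨r, hr⟩ := (hs.image bound).bddAbove
  exact ⟨max 0 r, le_max_left _ _, fun v hv =>
    boundedPart_mono ((hr (Set.mem_image_of_mem _ hv)).trans (le_max_right _ _)) (mem_bound v)⟩

end BoundedPart

section GradedAlgebra

variable {ι k A : Type*} [AddMonoid ι] [CommRing k] [Ring A] [Algebra k A]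

theorem mul_mem_gradedPart {𝒜 : ι → Submodule k A} [SetLike.GradedMonoid 𝒜] {T T' T'' : Set ι}
    (hT : ∀ d ∈ T, ∀ e ∈ T', d + e ∈ T'') {a b : A} (ha : a ∈ gradedPart 𝒜 T)
    (hb : b ∈ gradedPart 𝒜 T') : a * b ∈ gradedPart 𝒜 T'' := by
  refine Submodule.mul_le.1 ?_ a ha b hb
  simp only [gradedPart, Submodule.iSup_mul, Submodule.mul_iSup]
  exact iSup₂_le fun e he => iSup₂_le fun d hd => Submodule.mul_le.2 fun x hx y hy =>
    mem_gradedPart_of_mem (hT d hd e he) (SetLike.mul_mem_graded hx hy)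

variable {𝒜 : ℝ → Submodule k A} [SetLike.GradedMonoid 𝒜]

theorem one_mem_boundedPart {r : ℝ} (hr : 0 ≤ r) : (1 : A) ∈ boundedPart 𝒜 r :=
  mem_boundedPart_of_mem (abs_zero.trans_le hr) SetLike.GradedOne.one_mem

theorem mul_mem_boundedPart {r s : ℝ} {a b : A} (ha : a ∈ boundedPart 𝒜 r)
    (hb : b ∈ boundedPart 𝒜 s) : a * b ∈ boundedPart 𝒜 (r + s) :=
  mul_mem_gradedPart (fun d hd e he => (abs_add_le d e).trans (add_le_add hd he)) ha hb

theorem list_prod_mem_boundedPart {r : ℝ} {l : List A} (hl : ∀ a ∈ l, a ∈ boundedPart 𝒜 r) :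
    l.prod ∈ boundedPart 𝒜 (l.length * r) := by
  induction l with
  | nil => exact one_mem_boundedPart (by simp)
  | cons a l ih =>
    rw [List.forall_mem_cons] at hl
    rw [List.prod_cons, List.length_cons, Nat.cast_succ, add_one_mul, add_comm]
    exact mul_mem_boundedPart hl.1 (ih hl.2)

theorem pow_mem_boundedPart {r : ℝ} {a : A} (ha : a ∈ boundedPart 𝒜 r) (n : ℕ) :
    a ^ n ∈ boundedPart 𝒜 (n * r) := by
  have := list_prod_mem_boundedPart (l := List.replicate n a) fun b hb =>
    List.eq_of_mem_replicate hb ▸ ha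
  rwa [List.prod_replicate, List.length_replicate] at this

end GradedAlgebra

/-! ### Locally nilpotent subsets -/

section LocallyNilpotent

variable {k A : Type*} [CommRing k] [Ring A] [Algebra k A]

theorem IsLocallyNilpotent.isNilpotent {V : Set A} (hV : IsLocallyNilpotent k V) {a : A}
    (ha : a ∈ V) : IsNilpotent a := by
  obtain ⟨n, hn⟩ := hV {a} (by simpa using ha)
  refine ⟨n, ?_⟩
  rw [← List.prod_replicate]
  refine hn _ List.length_replicate fun x hx => ?_
  rw [List.eq_of_mem_replicate hx]
  exact NonUnitalAlgebra.subset_adjoin k (by simp)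

variable (k) in
/-- The span of the products of at least `n` elements of `F`: for `n ≥ 1`, the `n`-th power of the
non-unital subalgebra generated by `F`. -/
def longProducts (F : Set A) (n : ℕ) : Submodule k A :=
  Submodule.span k {u | ∃ l : List A, n ≤ l.length ∧ (∀ x ∈ l, x ∈ F) ∧ l.prod = u}

theorem mul_mem_longProducts {F : Set A} {m n : ℕ} {u v : A} (hu : u ∈ longProducts k F m)
    (hv : v ∈ longProducts k F n) : u * v ∈ longProducts k F (m + n) := by
  refine Submodule.mul_le.1 ?_ u hu v hv
  rw [longProducts, longProducts, Submodule.span_mul_span]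
  refine Submodule.span_mono ?_
  rintro _ ⟨_, ⟨l, hl, hlF, rfl⟩, _, ⟨l', hl', hlF', rfl⟩, rfl⟩
  refine ⟨l ++ l', by rw [List.length_append]; omega, fun x hx => ?_, by simp⟩
  exact (List.mem_append.1 hx).elim (hlF x) (hlF' x)

theorem mem_longProducts_of_mem_adjoin {F : Set A} {u : A}
    (hu : u ∈ NonUnitalAlgebra.adjoin k F) : u ∈ longProducts k F 1 := by
  have antitone : longProducts k F (1 + 1) ≤ longProducts k F 1 := Submodule.span_mono
    fun u ⟨l, hl, hlF⟩ => ⟨l, (Nat.le_succ 1).trans hl, hlF⟩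
  induction hu using NonUnitalAlgebra.adjoin_induction with
  | mem x hx => exact Submodule.subset_span ⟨[x], by simp, by simpa using hx, by simp⟩
  | add x y _ _ hx hy => exact add_mem hx hy
  | zero => exact zero_mem _
  | mul x y _ _ hx hy => exact antitone (mul_mem_longProducts hx hy)
  | smul c x _ hx => exact Submodule.smul_mem _ c hx

theorem isLocallyNilpotent_of_prod_eq_zero {V : Set A}
    (h : ∀ F : Finset A, (F : Set A) ⊆ V → ∃ n : ℕ, ∀ l : List A, n ≤ l.length →
      (∀ x ∈ l, x ∈ F) → l.prod = 0) : IsLocallyNilpotent k V := by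
  intro F hF
  obtain ⟨n, hn⟩ := h F hF
  refine ⟨n, fun l hl hlF => ?_⟩
  have prod_mem : l.prod ∈ longProducts k (F : Set A) l.length := by
    clear hl
    induction l with
    | nil => exact Submodule.subset_span ⟨[], le_rfl, by simp, rfl⟩
    | cons x l ih =>
      rw [List.forall_mem_cons] at hlF
      rw [List.prod_cons, List.length_cons, add_comm]
      exact mul_mem_longProducts (mem_longProducts_of_mem_adjoin hlF.1) (ih hlF.2)
  have longProducts_eq_bot : longProducts k (F : Set A) n = ⊥ := by
    refine Submodule.span_eq_bot.2 ?_
    rintro _ ⟨l, hl, hlF, rfl⟩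
    exact hn l hl hlF
  rwa [hl, longProducts_eq_bot, Submodule.mem_bot] at prod_mem

theorem exists_pos_forall_mem_gradedPart {M : Type*} [AddCommGroup M] [Module k M]
    {V : ℝ → Submodule k M} {s : SignType} (hs : s ≠ 0) {F : Set M} (hF : F.Finite)
    (hFV : F ⊆ gradedPart V {d | SignType.sign d = s}) :
    ∃ η : ℝ, 0 < η ∧ F ⊆ gradedPart V {d | η ≤ s * d} := by
  have antitone {η η' : ℝ} (h : η ≤ η') :
      gradedPart V {d | η' ≤ s * d} ≤ gradedPart V {d | η ≤ s * d} :=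
    gradedPart_mono fun d hd => h.trans hd
  have exists_mem (u : M) (hu : u ∈ gradedPart V {d | SignType.sign d = s}) :
      ∃ η : ℝ, 0 < η ∧ u ∈ gradedPart V {d | η ≤ s * d} := by
    rw [gradedPart, iSup_subtype'] at hu
    refine Submodule.iSup_induction _
      (motive := fun u => ∃ η : ℝ, 0 < η ∧ u ∈ gradedPart V {d | η ≤ s * d}) hu ?_
      ⟨1, one_pos, zero_mem _⟩ ?_
    · rintro ⟨d, rfl⟩ v hv
      refine ⟨|d|, abs_pos.2 (sign_ne_zero.1 hs), mem_gradedPart_of_mem (d := d) ?_ hv⟩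
      exact (sign_mul_self d).ge
    · rintro v w ⟨η, h0, hv⟩ ⟨η', h0', hw⟩
      exact ⟨min η η', lt_min h0 h0', add_mem (antitone (min_le_left _ _) hv)
        (antitone (min_le_right _ _) hw)⟩
  choose! η η_pos mem_η using exists_mem
  rcases F.eq_empty_or_nonempty with rfl | hne
  · exact ⟨1, one_pos, Set.empty_subset _⟩
  · obtain ⟨v, hv, hmin⟩ := Set.exists_min_image F η hF hne
    exact ⟨η v, η_pos v (hFV hv), fun u hu => antitone (hmin u hu) (mem_η u (hFV hu))⟩

section GradedAlgebra

variable {𝒜 ℬ : ℝ → Submodule k A} [SetLike.GradedMonoid 𝒜] [SetLike.GradedMonoid ℬ]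

theorem list_prod_mem_gradedPart_le_mul {c η : ℝ} {l : List A}
    (hl : ∀ a ∈ l, a ∈ gradedPart ℬ {d | η ≤ c * d}) :
    l.prod ∈ gradedPart ℬ {d | l.length * η ≤ c * d} := by
  induction l with
  | nil => exact mem_gradedPart_of_mem (d := 0) (by simp) SetLike.GradedOne.one_mem
  | cons a l ih =>
    rw [List.forall_mem_cons] at hl
    refine mul_mem_gradedPart (fun d (hd : η ≤ c * d) e (he : l.length * η ≤ c * e) => ?_)
      hl.1 (ih hl.2)
    rw [Set.mem_ofPred_eq, List.length_cons]
    push_cast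
    linarith

theorem isLocallyNilpotent_gradedPart_sign (h𝒜 : ⨆ m, 𝒜 m = ⊤) (hℬ : iSupIndep ℬ)
    (hgrowth : ∀ ε : ℝ, 0 < ε → ∃ C : ℝ, ∀ m, 𝒜 m ≤ boundedPart ℬ (C + ε * m))
    {s : SignType} (hs : s ≠ 0) :
    IsLocallyNilpotent k (gradedPart ℬ {d | SignType.sign d = s} : Set A) := by
  refine isLocallyNilpotent_of_prod_eq_zero fun F hF => ?_
  obtain ⟨η, η_pos, mem_η⟩ := exists_pos_forall_mem_gradedPart hs F.finite_toSet hF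
  obtain ⟨m, m_nonneg, mem_m⟩ := exists_subset_boundedPart h𝒜 F.finite_toSet
  obtain ⟨ε, ε_pos, hε⟩ : ∃ ε : ℝ, 0 < ε ∧ ε * m < η := by
    refine ⟨η / (m + 1), by positivity, ?_⟩
    rw [div_mul_eq_mul_div, div_lt_iff₀ (by positivity)]
    linarith
  obtain ⟨C, hC⟩ := hgrowth ε ε_pos
  obtain ⟨n, hn⟩ := exists_nat_gt (C / (η - ε * m))
  rw [div_lt_iff₀ (sub_pos.2 hε)] at hn
  refine ⟨n, fun l hl hlF => ?_⟩
  have prod_mem_bounded : l.prod ∈ boundedPart ℬ (C + ε * (l.length * m)) := by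
    refine boundedPart_le.2 (fun d hd => (hC d).trans (boundedPart_mono ?_))
      (list_prod_mem_boundedPart fun x hx => mem_m (hlF x hx))
    have := (le_abs_self d).trans hd
    gcongr
  have prod_mem_sign := list_prod_mem_gradedPart_le_mul fun x hx => mem_η (hlF x hx)
  refine Submodule.disjoint_def.1 (disjoint_gradedPart hℬ ?_) _ prod_mem_bounded prod_mem_sign
  refine Set.disjoint_left.2 fun d hd hd' => ?_
  rw [Set.mem_ofPred_eq] at hd hd'
  have sign_mul_le : s * d ≤ |d| := by
    cases s <;> simp [le_abs_self, neg_le_abs]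
  have : (n : ℝ) * (η - ε * m) ≤ l.length * (η - ε * m) := by
    have := sub_pos.2 hε
    gcongr
  linarith

end GradedAlgebra

end LocallyNilpotent

/-! ### The grading of the restricted enveloping algebra -/

section RestrictedHom

variable {k L : Type*} [CommRing k] [LieRing L] [LieAlgebra k L] {p : ℕ} {f : L → L}
variable {A : Type*} [Ring A] [Algebra k A]

/-- `φ` is a homomorphism of restricted Lie algebras from `(L, f)` to the associative algebra `A`
with the commutator bracket and the `p`-mapping `a ↦ a ^ p`. -/
structure IsRestrictedHom (p : ℕ) (f : L → L) (φ : L →ₗ[k] A) : Prop where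
  map_lie : ∀ a b, φ ⁅a, b⁆ = φ a * φ b - φ b * φ a
  map_pMap : ∀ a, φ (f a) = φ a ^ p

/-- `ℒ` is a grading of the restricted Lie algebra `(L, f)` by the real numbers. -/
structure IsRestrictedGrading (p : ℕ) (f : L → L) (ℒ : ℝ → Submodule k L) : Prop where
  isInternal : DirectSum.IsInternal ℒ
  lie_mem : ∀ d e, ∀ a ∈ ℒ d, ∀ b ∈ ℒ e, ⁅a, b⁆ ∈ ℒ (d + e)
  pMap_mem : ∀ d, ∀ a ∈ ℒ d, f a ∈ ℒ (p * d)

theorem IsSelfSimilarGrading.isRestrictedGrading {X : Type*} [CommRing X] [Algebra k X]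
    {ψ : L →ₗ⁅k⁆ Wreath k X L} {dil : ℝ} {𝒳 : ℝ → Submodule k X} {ℒ : ℝ → Submodule k L}
    (h : IsSelfSimilarGrading p f ψ dil 𝒳 ℒ) : IsRestrictedGrading p f ℒ where
  isInternal := h.isInternal
  lie_mem d e a ha b hb := h.lie_mem d e a b ha hb
  pMap_mem := h.pMap_mem

theorem IsPMap.map_zero [hp : Fact p.Prime] (hf : IsPMap k p f) : f 0 = 0 := by
  simpa [hp.out.ne_zero] using hf.smul 0 0

attribute [local instance] LieRing.ofAssociativeRing in
theorem IsPMap.apply_add_eq_pow [Fact p.Prime] (hf : IsPMap k p f) (h0 : (p : A) = 0)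
    {φ : L →ₗ[k] A} (map_lie : ∀ a b, φ ⁅a, b⁆ = φ a * φ b - φ b * φ a) {a b : L}
    (ha : φ (f a) = φ a ^ p) (hb : φ (f b) = φ b ^ p) : φ (f (a + b)) = φ (a + b) ^ p := by
  have map_jacobson : φ (jacobsonSum p a b) = jacobsonSum p (φ a) (φ b) :=
    map_jacobsonSum φ.toAddMonoidHom map_lie p a b
  rw [hf.add, map_add, map_add, map_add, ha, hb, map_jacobson, add_pow_eq_jacobsonSum _ _ h0]

theorem isRestrictedHom_of_iSup_eq_top [hp : Fact p.Prime] (hf : IsPMap k p f)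
    (h0 : (p : A) = 0) {ι : Type*} {V : ι → Submodule k L} (hV : ⨆ d, V d = ⊤) {φ : L →ₗ[k] A}
    (map_lie : ∀ d e, ∀ a ∈ V d, ∀ b ∈ V e, φ ⁅a, b⁆ = φ a * φ b - φ b * φ a)
    (map_pMap : ∀ d, ∀ a ∈ V d, φ (f a) = φ a ^ p) : IsRestrictedHom p f φ := by
  have mem_iSup (a : L) : a ∈ ⨆ d, V d := hV ▸ Submodule.mem_top
  have map_lie' (a b : L) : φ ⁅a, b⁆ = φ a * φ b - φ b * φ a := by
    induction mem_iSup a using Submodule.iSup_induction' with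
    | mem d a ha =>
      induction mem_iSup b using Submodule.iSup_induction' with
      | mem e b hb => exact map_lie d e a ha b hb
      | zero => simp
      | add b c _ _ hb hc => rw [lie_add, map_add, map_add, hb, hc]; noncomm_ring
    | zero => simp
    | add a c _ _ ha hc => rw [add_lie, map_add, map_add, ha, hc]; noncomm_ring
  refine ⟨map_lie', fun a => ?_⟩
  induction mem_iSup a using Submodule.iSup_induction' with
  | mem d a ha => exact map_pMap d a ha
  | zero => rw [hf.map_zero, _root_.map_zero, zero_pow hp.out.ne_zero]
  | add a b _ _ ha hb => exact hf.apply_add_eq_pow h0 map_lie' ha hb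

namespace Enveloping

theorem isRestrictedHom_ι : IsRestrictedHom p f (ι k p f) where
  map_lie a b := by
    have := RingQuot.mkAlgHom_rel k (EnvelopingRel.lie (k := k) (p := p) (f := f) a b)
    rw [map_sub, map_mul, map_mul] at this
    exact this.symm
  map_pMap a := by
    have := RingQuot.mkAlgHom_rel k (EnvelopingRel.pow (k := k) (p := p) (f := f) a)
    rw [map_pow] at this
    exact this.symm

theorem exists_lift {φ : L →ₗ[k] A} (hφ : IsRestrictedHom p f φ) :
    ∃ Φ : Enveloping k p f →ₐ[k] A, ∀ a, Φ (ι k p f a) = φ a := by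
  have lift_eq : ∀ ⦃x y⦄, EnvelopingRel k p f x y →
      TensorAlgebra.lift k φ x = TensorAlgebra.lift k φ y := by
    rintro _ _ (⟨a, b⟩ | a)
    · simp [hφ.map_lie]
    · simp [hφ.map_pMap]
  exact ⟨RingQuot.liftAlgHom k ⟨TensorAlgebra.lift k φ, lift_eq⟩, fun a =>
    (RingQuot.liftAlgHom_mkAlgHom_apply k _ lift_eq _).trans (TensorAlgebra.lift_ι_apply φ a)⟩

theorem induction_on {C : Enveloping k p f → Prop} (u : Enveloping k p f)
    (algebraMap : ∀ c, C (algebraMap k _ c)) (ι : ∀ a, C (ι k p f a))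
    (mul : ∀ u v, C u → C v → C (u * v)) (add : ∀ u v, C u → C v → C (u + v)) : C u := by
  obtain ⟨t, rfl⟩ := RingQuot.mkAlgHom_surjective k (EnvelopingRel k p f) u
  induction t using TensorAlgebra.induction with
  | algebraMap c => rw [AlgHom.commutes]; exact algebraMap c
  | ι a => exact ι a
  | mul s t hs ht => rw [map_mul]; exact mul _ _ hs ht
  | add s t hs ht => rw [map_add]; exact add _ _ hs ht

variable {ℒ : ℝ → Submodule k L}

theorem ι_mem_homogeneous {d : ℝ} {a : L} (ha : a ∈ ℒ d) :
    ι k p f a ∈ homogeneous k p f ℒ d :=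
  Submodule.subset_span ⟨[(d, a)], by simpa using ha, by simp, by simp⟩

instance : SetLike.GradedMonoid (homogeneous k p f ℒ) where
  one_mem := Submodule.subset_span ⟨[], by simp, by simp, by simp⟩
  mul_mem d e u v hu hv := by
    refine Submodule.mul_le.1 ?_ u hu v hv
    rw [homogeneous, homogeneous, Submodule.span_mul_span]
    refine Submodule.span_mono ?_
    rintro _ ⟨_, ⟨l, hl, hd, rfl⟩, _, ⟨l', hl', he, rfl⟩, rfl⟩
    exact ⟨l ++ l', List.forall_mem_append.2 ⟨hl, hl'⟩, by simp [hd, he], by simp⟩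

theorem iSup_homogeneous (hℒ : ⨆ d, ℒ d = ⊤) : ⨆ d, homogeneous k p f ℒ d = ⊤ := by
  have gradedPart_univ : gradedPart (homogeneous k p f ℒ) Set.univ = ⨆ d, homogeneous k p f ℒ d :=
    iSup_univ
  have map_ι_le : ⨆ d, ℒ d ≤ (⨆ d, homogeneous k p f ℒ d).comap (ι k p f) :=
    iSup_le fun d a ha => Submodule.mem_iSup_of_mem d (ι_mem_homogeneous ha)
  refine eq_top_iff.2 fun u _ => ?_
  induction u using induction_on with
  | algebraMap c =>
    rw [Algebra.algebraMap_eq_smul_one]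
    exact Submodule.smul_mem _ _ (Submodule.mem_iSup_of_mem 0 SetLike.GradedOne.one_mem)
  | ι a => exact map_ι_le (hℒ ▸ Submodule.mem_top)
  | mul u v hu hv =>
    rw [← gradedPart_univ] at hu hv ⊢
    exact mul_mem_gradedPart (fun _ _ _ _ => Set.mem_univ _) (hu trivial) (hv trivial)
  | add u v hu hv => exact add_mem (hu trivial) (hv trivial)

theorem exists_isRestrictedHom_eq_single [Fact p.Prime] [CharP k p] (hf : IsPMap k p f)
    (hℒ : IsRestrictedGrading p f ℒ) :
    ∃ φ : L →ₗ[k] AddMonoidAlgebra (Enveloping k p f) ℝ, IsRestrictedHom p f φ ∧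
      ∀ d, ∀ a ∈ ℒ d, φ a = AddMonoidAlgebra.single d (ι k p f a) := by
  obtain ⟨θ, hθ⟩ := exists_apply_eq_single hℒ.isInternal
  let φ : L →ₗ[k] AddMonoidAlgebra (Enveloping k p f) ℝ :=
    (AddMonoidAlgebra.coeffLinearEquiv k).symm.toLinearMap ∘ₗ
      Finsupp.mapRange.linearMap (ι k p f) ∘ₗ θ
  have φ_eq_single (d) (a) (ha : a ∈ ℒ d) : φ a = AddMonoidAlgebra.single d (ι k p f a) := by
    simp only [φ, LinearMap.comp_apply, hθ d a ha, Finsupp.mapRange.linearMap_apply,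
      Finsupp.mapRange_single]
    rfl
  have cast_eq_zero : (p : AddMonoidAlgebra (Enveloping k p f) ℝ) = 0 := by
    rw [← map_natCast (algebraMap k _), CharP.cast_eq_zero, map_zero]
  refine ⟨φ, isRestrictedHom_of_iSup_eq_top hf cast_eq_zero hℒ.isInternal.submodule_iSup_eq_top
    (fun d e a ha b hb => ?_) fun d a ha => ?_, φ_eq_single⟩
  · rw [φ_eq_single d a ha, φ_eq_single e b hb, φ_eq_single _ _ (hℒ.lie_mem d e a ha b hb),
      AddMonoidAlgebra.single_mul_single, AddMonoidAlgebra.single_mul_single, add_comm e d,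
      isRestrictedHom_ι.map_lie, AddMonoidAlgebra.single_sub]
  · rw [φ_eq_single d a ha, φ_eq_single _ _ (hℒ.pMap_mem d a ha), AddMonoidAlgebra.single_pow,
      isRestrictedHom_ι.map_pMap, nsmul_eq_mul]

theorem map_eq_single_of_mem_homogeneous
    {Φ : Enveloping k p f →ₐ[k] AddMonoidAlgebra (Enveloping k p f) ℝ}
    (hΦ : ∀ d, ∀ a ∈ ℒ d, Φ (ι k p f a) = AddMonoidAlgebra.single d (ι k p f a)) {d : ℝ}
    {u : Enveloping k p f} (hu : u ∈ homogeneous k p f ℒ d) :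
    Φ u = AddMonoidAlgebra.single d u := by
  induction hu using Submodule.span_induction with
  | mem u hu =>
    obtain ⟨l, hl, rfl, rfl⟩ := hu
    induction l with
    | nil => simpa using AddMonoidAlgebra.one_def
    | cons q l ih =>
      rw [List.forall_mem_cons] at hl
      rw [List.map_cons, List.prod_cons, map_mul, ih hl.2, hΦ _ _ hl.1,
        AddMonoidAlgebra.single_mul_single, List.map_cons, List.sum_cons]
  | zero => simp
  | add u v _ _ hu hv => rw [map_add, hu, hv, AddMonoidAlgebra.single_add]
  | smul c u _ hu => rw [map_smul, hu, AddMonoidAlgebra.smul_single]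

theorem isInternal_homogeneous [Fact p.Prime] [CharP k p] (hf : IsPMap k p f)
    (hℒ : IsRestrictedGrading p f ℒ) : DirectSum.IsInternal (homogeneous k p f ℒ) := by
  obtain ⟨φ, hφ, φ_eq_single⟩ := exists_isRestrictedHom_eq_single hf hℒ
  obtain ⟨Φ, hΦ⟩ := exists_lift hφ
  refine DirectSum.isInternal_submodule_of_iSupIndep_of_iSup_eq_top
    (iSupIndep_of_apply_eq_single
      ((AddMonoidAlgebra.coeffLinearEquiv k).toLinearMap ∘ₗ Φ.toLinearMap) fun d u hu => ?_)
    (iSup_homogeneous hℒ.isInternal.submodule_iSup_eq_top)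
  rw [LinearMap.comp_apply, AlgHom.toLinearMap_apply, map_eq_single_of_mem_homogeneous
    (fun e a ha => (hΦ a).trans (φ_eq_single e a ha)) hu]
  rfl

theorem isInternal_signPart [Fact p.Prime] [CharP k p] (hf : IsPMap k p f)
    (hℒ : IsRestrictedGrading p f ℒ) : DirectSum.IsInternal (signPart k p f ℒ) :=
  isInternal_gradedPart_preimage (isInternal_homogeneous hf hℒ) SignType.sign

theorem homogeneous_le_signPart (d : ℝ) :
    homogeneous k p f ℒ d ≤ signPart k p f ℒ (SignType.sign d) :=
  fun _ hu => mem_gradedPart_of_mem (T := {e | SignType.sign e = SignType.sign d}) rfl hu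

theorem one_mem_signPart : (1 : Enveloping k p f) ∈ signPart k p f ℒ 0 :=
  mem_gradedPart_of_mem (d := 0) sign_zero SetLike.GradedOne.one_mem

theorem mul_mem_signPart {s : SignType} {u v : Enveloping k p f}
    (hu : u ∈ signPart k p f ℒ s) (hv : v ∈ signPart k p f ℒ s) :
    u * v ∈ signPart k p f ℒ s := by
  refine mul_mem_gradedPart (T := {d | SignType.sign d = s}) (T' := {d | SignType.sign d = s})
    (T'' := {d | SignType.sign d = s}) (fun d hd e he => ?_) hu hv
  rw [Set.mem_ofPred_eq] at hd he ⊢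
  cases s with
  | zero => simp_all [sign_eq_zero_iff]
  | pos => simp_all [sign_eq_one_iff, add_pos]
  | neg => simp_all [sign_eq_neg_one_iff, add_neg]

end Enveloping

end RestrictedHom

/-! ### Generators of positive degree -/

section PositiveSpanningSet

variable {k M : Type*} [CommRing k] [AddCommGroup M] [Module k M]

/-- `G` is a set of elements of positive degree, each recorded with its degree, that spans every
component of the family `V` and has only finitely many elements up to any given degree. -/
structure IsPositiveSpanningSet (V : ℝ → Submodule k M) (G : Set (ℝ × M)) : Prop where
  pos : ∀ q ∈ G, 0 < q.1
  finite : ∀ N : ℝ, {q ∈ G | q.1 ≤ N}.Finite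
  span_eq : ∀ d, Submodule.span k {v | (d, v) ∈ G} = V d

namespace IsPositiveSpanningSet

variable {V : ℝ → Submodule k M} {G : Set (ℝ × M)}

theorem mem (hG : IsPositiveSpanningSet V G) {q : ℝ × M} (hq : q ∈ G) : q.2 ∈ V q.1 :=
  hG.span_eq q.1 ▸ Submodule.subset_span hq

theorem eq_bot (hG : IsPositiveSpanningSet V G) {d : ℝ} (hd : d ≤ 0) : V d = ⊥ := by
  rw [← hG.span_eq, Submodule.span_eq_bot]
  exact fun v hv => absurd (hG.pos _ hv) (not_lt.2 hd)

theorem map {N : Type*} [AddCommGroup N] [Module k N] (hG : IsPositiveSpanningSet V G)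
    (φ : M →ₗ[k] N) :
    IsPositiveSpanningSet (fun d => (V d).map φ) ((fun q => (q.1, φ q.2)) '' G) where
  pos := Set.forall_mem_image.2 hG.pos
  finite N := ((hG.finite N).image fun q => (q.1, φ q.2)).subset <| by
    rintro _ ⟨⟨q, hq, rfl⟩, hle⟩
    exact ⟨q, ⟨hq, hle⟩, rfl⟩
  span_eq d := by
    rw [← hG.span_eq d, Submodule.map_span]
    congr 1
    ext w
    simp

end IsPositiveSpanningSet

end PositiveSpanningSet

section Generators

variable {k L : Type*} [CommRing k] [LieRing L] [LieAlgebra k L] {p : ℕ} {f : L → L}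

/-- `a` is obtained from the elements of `G` by Lie brackets and the `p`-mapping `f`, and `d` is
the degree of this expression, given the degrees that are recorded in `G`. -/
inductive RestrictedMonomial (p : ℕ) (f : L → L) (G : Set (ℝ × L)) : ℝ → L → Prop
  | gen {d a} : (d, a) ∈ G → RestrictedMonomial p f G d a
  | lie {d e a b} : RestrictedMonomial p f G d a → RestrictedMonomial p f G e b →
      RestrictedMonomial p f G (d + e) ⁅a, b⁆
  | pMap {d a} : RestrictedMonomial p f G d a → RestrictedMonomial p f G (p * d) (f a)

namespace RestrictedMonomial

variable {G : Set (ℝ × L)}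

section Degree

variable [hp : Fact p.Prime] {δ : ℝ}

theorem le_degree (hδ : 0 < δ) (hG : ∀ q ∈ G, δ ≤ q.1) {d : ℝ} {a : L}
    (h : RestrictedMonomial p f G d a) : δ ≤ d := by
  induction h with
  | gen h => exact hG _ h
  | lie _ _ hd he => linarith
  | pMap _ hd =>
    exact hd.trans (le_mul_of_one_le_left (hδ.le.trans hd) (mod_cast hp.out.one_le))

/-- A bracket or a `p`-th power has degree at least `δ` more than each of its arguments. -/
theorem finite_degree_lt_mul (hδ : 0 < δ) (hG : ∀ q ∈ G, δ ≤ q.1) (hfin : G.Finite) (n : ℕ) :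
    {q : ℝ × L | RestrictedMonomial p f G q.1 q.2 ∧ q.1 < n * δ}.Finite := by
  induction n with
  | zero =>
    refine Set.finite_empty.subset ?_
    rintro q ⟨hq, hlt⟩
    rw [Nat.cast_zero, zero_mul] at hlt
    exact (hlt.trans hδ).not_ge (hq.le_degree hδ hG)
  | succ n ih =>
    refine (hfin.union ((ih.image2 (fun q r => (q.1 + r.1, ⁅q.2, r.2⁆)) ih).union
      (ih.image fun q => ((p : ℝ) * q.1, f q.2)))).subset ?_
    rintro ⟨d, a⟩ ⟨hq, hlt⟩
    replace hq : RestrictedMonomial p f G d a := hq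
    replace hlt : d < n * δ + δ := by simpa [add_one_mul] using hlt
    cases hq with
    | gen h => exact .inl h
    | @lie d e a b ha hb =>
      have hd := ha.le_degree hδ hG
      have he := hb.le_degree hδ hG
      have hd' : d < n * δ := by linarith
      have he' : e < n * δ := by linarith
      exact .inr (.inl ⟨(d, a), ⟨ha, hd'⟩, (e, b), ⟨hb, he'⟩, rfl⟩)
    | @pMap d a ha =>
      have hd := ha.le_degree hδ hG
      have two_mul_le : 2 * d ≤ p * d :=
        mul_le_mul_of_nonneg_right (mod_cast hp.out.two_le) (hδ.le.trans hd)
      have hd' : d < n * δ := by linarith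
      exact .inr (.inr ⟨(d, a), ⟨ha, hd'⟩, rfl⟩)

theorem finite_degree_le (hδ : 0 < δ) (hG : ∀ q ∈ G, δ ≤ q.1) (hfin : G.Finite) (N : ℝ) :
    {q : ℝ × L | RestrictedMonomial p f G q.1 q.2 ∧ q.1 ≤ N}.Finite := by
  obtain ⟨n, hn⟩ := exists_nat_gt (N / δ)
  rw [div_lt_iff₀ hδ] at hn
  exact (finite_degree_lt_mul hδ hG hfin n).subset fun q hq => ⟨hq.1, hq.2.trans_lt hn⟩

end Degree

theorem span_eq_top [Fact p.Prime] (hf : IsPMap k p f)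
    (hG : GeneratesRestricted k f (Prod.snd '' G)) :
    Submodule.span k {a | ∃ d, RestrictedMonomial p f G d a} = ⊤ := by
  set V := Submodule.span k {a | ∃ d, RestrictedMonomial p f G d a}
  have lie_mem (a b) (ha : a ∈ V) (hb : b ∈ V) : ⁅a, b⁆ ∈ V := by
    refine LinearMap.BilinMap.apply_apply_mem_of_mem_span V _ _
      (LieModule.toEnd k L L : L →ₗ[k] Module.End k L) ?_ a b ha hb
    rintro a ⟨d, ha⟩ b ⟨e, hb⟩
    exact Submodule.subset_span ⟨d + e, ha.lie hb⟩
  have pMap_mem (a) (ha : a ∈ V) : f a ∈ V := by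
    induction ha using Submodule.span_induction with
    | mem a ha =>
      obtain ⟨d, hd⟩ := ha
      exact Submodule.subset_span ⟨_, hd.pMap⟩
    | zero => rw [hf.map_zero]; exact zero_mem _
    | add a b ha hb hfa hfb =>
      rw [hf.add]
      exact add_mem (add_mem hfa hfb) (jacobsonSum_mem lie_mem p ha hb)
    | smul c a _ ha => rw [hf.smul]; exact Submodule.smul_mem _ _ ha
  refine congrArg LieSubalgebra.toSubmodule (hG { V with lie_mem' := lie_mem _ _ } ?_ pMap_mem)
  rintro _ ⟨q, hq, rfl⟩
  exact Submodule.subset_span ⟨q.1, .gen hq⟩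

variable {ℒ : ℝ → Submodule k L}

theorem mem (hℒ : IsRestrictedGrading p f ℒ) (hG : ∀ q ∈ G, q.2 ∈ ℒ q.1) {d : ℝ} {a : L}
    (h : RestrictedMonomial p f G d a) : a ∈ ℒ d := by
  induction h with
  | gen h => exact hG _ h
  | lie _ _ ha hb => exact hℒ.lie_mem _ _ _ ha _ hb
  | pMap _ ha => exact hℒ.pMap_mem _ _ ha

theorem span_eq [Fact p.Prime] (hf : IsPMap k p f) (hℒ : IsRestrictedGrading p f ℒ)
    (hG : ∀ q ∈ G, q.2 ∈ ℒ q.1) (hgen : GeneratesRestricted k f (Prod.snd '' G)) (d : ℝ) :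
    Submodule.span k {a | RestrictedMonomial p f G d a} = ℒ d := by
  have span_le (d) : Submodule.span k {a | RestrictedMonomial p f G d a} ≤ ℒ d :=
    Submodule.span_le.2 fun a ha => mem hℒ hG ha
  refine congrFun ((hℒ.isInternal.submodule_iSupIndep.le_iff_eq_of_iSup_eq_top ?_).1 span_le) d
  rw [← Submodule.span_iUnion, ← span_eq_top hf hgen]
  congr 1
  ext a
  simp

end RestrictedMonomial

theorem exists_isPositiveSpanningSet [Fact p.Prime] (hf : IsPMap k p f)
    {ℒ : ℝ → Submodule k L} (hℒ : IsRestrictedGrading p f ℒ) {S : Set L} (hfin : S.Finite)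
    (hS : ∀ s ∈ S, ∃ d : ℝ, 0 < d ∧ s ∈ ℒ d) (hgen : GeneratesRestricted k f S) :
    ∃ G, IsPositiveSpanningSet ℒ G := by
  choose! deg deg_pos mem_deg using hS
  obtain ⟨δ, δ_pos, hδ⟩ : ∃ δ : ℝ, 0 < δ ∧ ∀ s ∈ S, δ ≤ deg s := by
    rcases S.eq_empty_or_nonempty with rfl | hne
    · exact ⟨1, one_pos, by simp⟩
    · obtain ⟨s, hs, hmin⟩ := Set.exists_min_image S deg hfin hne
      exact ⟨deg s, deg_pos s hs, hmin⟩
  set G : Set (ℝ × L) := (fun s => (deg s, s)) '' S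
  have snd_image : Prod.snd '' G = S := by
    simp [G, Set.image_image]
  have le_deg : ∀ q ∈ G, δ ≤ q.1 := Set.forall_mem_image.2 hδ
  have mem : ∀ q ∈ G, q.2 ∈ ℒ q.1 := Set.forall_mem_image.2 mem_deg
  exact ⟨{q | RestrictedMonomial p f G q.1 q.2},
    fun q hq => δ_pos.trans_le (hq.le_degree δ_pos le_deg),
    RestrictedMonomial.finite_degree_le δ_pos le_deg (hfin.image _),
    RestrictedMonomial.span_eq hf hℒ mem (snd_image ▸ hgen)⟩

end Generators

/-! ### Growth of self-similar Lie algebras -/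

section Growth

variable {k X L : Type*} [CommRing k] [CommRing X] [Algebra k X] [LieRing L] [LieAlgebra k L]

theorem IsFaithful.injective {ψ : L →ₗ⁅k⁆ Wreath k X L} (hψ : IsFaithful ψ) :
    Function.Injective ψ := by
  refine (injective_iff_map_eq_zero ψ).2 fun a ha => hψ a fun w => ?_
  cases w with
  | nil => rfl
  | cons x w => simp [naturalAction, ha]

/-- The elements of degree `d` of `X ⊗ L`, where `y ⊗ a` has degree `deg y + dil * deg a`. -/
def tensorDegree (dil : ℝ) (𝒳 : ℝ → Submodule k X) (ℒ : ℝ → Submodule k L) (d : ℝ) :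
    Submodule k (X ⊗[k] L) :=
  Submodule.span k {t : X ⊗[k] L | ∃ (e f : ℝ) (y : X) (a : L),
      y ∈ 𝒳 e ∧ a ∈ ℒ f ∧ e + dil * f = d ∧ t = y ⊗ₜ[k] a}

variable {𝒳 : ℝ → Submodule k X} {ℒ : ℝ → Submodule k L} {dil : ℝ}

theorem tmul_mem_boundedPart {r s : ℝ} {y : X} {a : L} (hy : y ∈ boundedPart 𝒳 r)
    (ha : a ∈ boundedPart ℒ s) :
    y ⊗ₜ[k] a ∈ boundedPart (tensorDegree dil 𝒳 ℒ) (r + |dil| * s) := by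
  refine (Submodule.map₂_le (f := TensorProduct.mk k X L)).1 ?_ y hy a ha
  simp only [boundedPart, gradedPart, Submodule.map₂_iSup_left, Submodule.map₂_iSup_right]
  refine iSup₂_le fun e he => iSup₂_le fun d hd => Submodule.map₂_le.2 fun y hy a ha =>
    mem_boundedPart_of_mem ?_ (Submodule.subset_span ⟨d, e, y, a, hy, ha, rfl, rfl⟩)
  calc |d + dil * e| ≤ |d| + |dil| * |e| := (abs_add_le _ _).trans_eq (by rw [abs_mul])
    _ ≤ r + |dil| * s := add_le_add hd (mul_le_mul_of_nonneg_left he (abs_nonneg _))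

theorem iSupIndep_tensorDegree (h𝒳 : DirectSum.IsInternal 𝒳) (hℒ : DirectSum.IsInternal ℒ) :
    iSupIndep (tensorDegree dil 𝒳 ℒ) := by
  obtain ⟨ξ, hξ⟩ := exists_apply_eq_single h𝒳
  obtain ⟨θ, hθ⟩ := exists_apply_eq_single hℒ
  refine iSupIndep_of_apply_eq_single
    (Finsupp.lmapDomain (X ⊗[k] L) k (fun q : ℝ × ℝ => q.1 + dil * q.2) ∘ₗ
      (finsuppTensorFinsupp k k X L ℝ ℝ).toLinearMap ∘ₗ TensorProduct.map ξ θ) fun d v hv => ?_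
  induction hv using Submodule.span_induction with
  | mem v hv =>
    obtain ⟨e, f, y, a, hy, ha, rfl, rfl⟩ := hv
    simp only [LinearMap.comp_apply, TensorProduct.map_tmul, hξ e y hy, hθ f a ha,
      LinearEquiv.coe_coe, finsuppTensorFinsupp_single, Finsupp.lmapDomain_apply,
      Finsupp.mapDomain_single]
  | zero => simp
  | add v w _ _ hv hw => rw [map_add, hv, hw, Finsupp.single_add]
  | smul c v _ hv => rw [map_smul, hv, Finsupp.smul_single]

theorem boundedPart_eq_top {M : Type*} [AddCommGroup M] [Module k M] {V : ℝ → Submodule k M}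
    (hV : ⨆ d, V d = ⊤) {r : ℝ} (hr : ∀ d, V d ≠ ⊥ → |d| ≤ r) : boundedPart V r = ⊤ := by
  refine eq_top_iff.2 (hV ▸ iSup_le fun d v hv => ?_)
  rcases eq_or_ne (V d) ⊥ with h | h
  · rw [h, Submodule.mem_bot] at hv
    rw [hv]
    exact zero_mem _
  · exact mem_boundedPart_of_mem (hr d h) hv

theorem eq_zero_of_map_mem_add {V : ℝ → Submodule k X} (hV : ⨆ d, V d = ⊤) {E : ℝ}
    (hE : ∀ e, V e ≠ ⊥ → |e| ≤ E) {d : ℝ} (hd : 2 * E < |d|) {g : X →ₗ[k] X}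
    (hg : ∀ e, ∀ x ∈ V e, g x ∈ V (d + e)) : g = 0 := by
  refine LinearMap.ker_eq_top.1 (eq_top_iff.2 (hV ▸ iSup_le fun e x hx => ?_))
  rcases eq_or_ne (V e) ⊥ with he | he
  · rw [he, Submodule.mem_bot] at hx
    rw [hx]
    exact zero_mem _
  have eq_bot : V (d + e) = ⊥ := by
    by_contra hde
    have := abs_sub (d + e) e
    rw [add_sub_cancel_right] at this
    linarith [hE e he, hE _ hde]
  exact (Submodule.mem_bot k).1 (eq_bot ▸ hg e x hx)

variable {p : ℕ} {f : L → L} {ψ : L →ₗ⁅k⁆ Wreath k X L}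

theorem IsSelfSimilarGrading.mem_boundedPart_of_left_mem (h : IsSelfSimilarGrading p f ψ dil 𝒳 ℒ)
    (hψ : Function.Injective ψ) {E : ℝ} (hE : ∀ e, 𝒳 e ≠ ⊥ → |e| ≤ E) {r : ℝ} (hr : 2 * E ≤ r)
    {a : L} (ha : (ψ a).left ∈ boundedPart (tensorDegree dil 𝒳 ℒ) r) : a ∈ boundedPart ℒ r := by
  refine mem_gradedPart_of_map_mem h.isInternal.submodule_iSup_eq_top
    (iSupIndep_tensorDegree h.alphabet_isInternal h.isInternal)
    (g := LieAlgebra.SemiDirectSum.projl (derAction k X L) ∘ₗ (ψ : L →ₗ[k] Wreath k X L))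
    (fun d b hb => (h.compatible d b hb).1) (fun d hd b hb left_eq_zero => ?_) ha
  have right_eq_zero : ((ψ b).right : X →ₗ[k] X) = 0 :=
    eq_zero_of_map_mem_add h.alphabet_isInternal.submodule_iSup_eq_top hE
      (hr.trans_lt (not_le.1 hd)) (h.compatible d b hb).2
  refine (map_eq_zero_iff ψ hψ).1 (LieAlgebra.SemiDirectSum.ext left_eq_zero ?_)
  exact Derivation.ext fun x => LinearMap.congr_fun right_eq_zero x

variable {𝒳lam 𝒳mu : ℝ → Submodule k X} {ℒlam ℒmu : ℝ → Submodule k L} {lam mu : ℝ}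

theorem tensorDegree_le_boundedPart (hlam : 0 < lam) (h𝒳mu : ⨆ e, 𝒳mu e = ⊤) {D E t R : ℝ}
    (hD : ∀ e, 𝒳lam e ≠ ⊥ → -D ≤ e) (hE : ∀ e, 𝒳mu e ≠ ⊥ → |e| ≤ E)
    (ht : ∀ g ≤ t, ℒlam g ≤ boundedPart ℒmu R) {d : ℝ} (hd : d ≤ lam * t - D) :
    tensorDegree lam 𝒳lam ℒlam d ≤ boundedPart (tensorDegree mu 𝒳mu ℒmu) (E + |mu| * R) := by
  refine Submodule.span_le.2 ?_
  rintro _ ⟨e, g, y, b, hy, hb, rfl, rfl⟩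
  rcases eq_or_ne (𝒳lam e) ⊥ with he | he
  · rw [he, Submodule.mem_bot] at hy
    rw [hy, TensorProduct.zero_tmul]
    exact zero_mem _
  have g_le : g ≤ t := le_of_mul_le_mul_left (by linarith [hD e he]) hlam
  exact tmul_mem_boundedPart (boundedPart_eq_top h𝒳mu hE ▸ Submodule.mem_top) (ht g g_le hb)

theorem IsSelfSimilarGrading.le_boundedPart_of_le (hlam : 0 < lam)
    (hgrlam : IsSelfSimilarGrading p f ψ lam 𝒳lam ℒlam)
    (hgrmu : IsSelfSimilarGrading p f ψ mu 𝒳mu ℒmu) (hψ : Function.Injective ψ) {D E t R : ℝ}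
    (hD : ∀ e, 𝒳lam e ≠ ⊥ → -D ≤ e) (hE : ∀ e, 𝒳mu e ≠ ⊥ → |e| ≤ E) (hE0 : 0 ≤ E)
    (hR : 0 ≤ R) (ht : ∀ g ≤ t, ℒlam g ≤ boundedPart ℒmu R) {d : ℝ} (hd : d ≤ lam * t - D) :
    ℒlam d ≤ boundedPart ℒmu (2 * E + |mu| * R) := fun a ha =>
  hgrmu.mem_boundedPart_of_left_mem hψ hE (le_add_of_nonneg_right (by positivity))
    (boundedPart_mono (by linarith) (tensorDegree_le_boundedPart hlam
      hgrmu.alphabet_isInternal.submodule_iSup_eq_top hD hE ht hd (hgrlam.compatible d a ha).1))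

theorem IsPositiveSpanningSet.exists_le_boundedPart {G : Set (ℝ × L)}
    (hG : IsPositiveSpanningSet ℒlam G) (hℒmu : ⨆ d, ℒmu d = ⊤) (t : ℝ) :
    ∃ R, 0 ≤ R ∧ ∀ d ≤ t, ℒlam d ≤ boundedPart ℒmu R := by
  obtain ⟨R, R_nonneg, mem_R⟩ :=
    exists_subset_boundedPart hℒmu ((hG.finite t).image Prod.snd)
  refine ⟨R, R_nonneg, fun d hd => ?_⟩
  rw [← hG.span_eq d]
  exact Submodule.span_le.2 fun a ha => mem_R ⟨(d, a), ⟨ha, hd⟩, rfl⟩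

section AffineRecursion

variable {P : ℝ → ℝ → Prop} {lam ν c D : ℝ}

theorem exists_forall_pow_of_affine_step (hP : ∀ ⦃t R R'⦄, R ≤ R' → P t R → P t R')
    (hν : 1 < ν) (hlam : 1 < lam) (hc : 0 ≤ c) (base : ∀ t, ∃ R, 0 ≤ R ∧ P t R)
    (step : ∀ t R, 0 ≤ R → P t R → P (lam * t - D) (c + ν * R)) :
    ∃ R, ∀ n : ℕ, P (D / (lam - 1) + lam ^ n) (R * ν ^ n) := by
  set s := D / (lam - 1)
  have lam_mul_s : lam * s - D = s := by
    have := (sub_pos.2 hlam).ne'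
    simp only [s]
    field_simp
    ring
  -- `-K` is the fixed point of `R ↦ c + ν * R`.
  set K := c / (ν - 1)
  have K_nonneg : 0 ≤ K := div_nonneg hc (sub_pos.2 hν).le
  have ν_mul_K : ν * K = c + K := by
    have := (sub_pos.2 hν).ne'
    simp only [K]
    field_simp
    ring
  obtain ⟨R, R_nonneg, hR⟩ := base (s + 1)
  refine ⟨R + K, fun n => hP (sub_le_self _ K_nonneg) ?_⟩
  induction n with
  | zero => simpa using hR
  | succ n ih =>
    have bound_nonneg : 0 ≤ (R + K) * ν ^ n - K := by
      have : K * 1 ≤ (R + K) * ν ^ n := by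
        gcongr
        · exact le_add_of_nonneg_left R_nonneg
        · exact one_le_pow₀ hν.le
      linarith
    convert step _ _ bound_nonneg ih using 1
    · rw [pow_succ]
      linear_combination -lam_mul_s
    · rw [pow_succ]
      linear_combination ν_mul_K

theorem eventually_of_affine_step (hP : ∀ ⦃t R R'⦄, R ≤ R' → P t R → P t R')
    (hP' : ∀ ⦃t t' R⦄, t ≤ t' → P t' R → P t R) (hν : 1 < ν) (hlam : ν < lam) (hc : 0 ≤ c)
    (hD : 0 ≤ D) (base : ∀ t, ∃ R, 0 ≤ R ∧ P t R)
    (step : ∀ t R, 0 ≤ R → P t R → P (lam * t - D) (c + ν * R)) {ε : ℝ} (hε : 0 < ε) :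
    ∀ᶠ t in Filter.atTop, P t (ε * t) := by
  have one_lt_lam := hν.trans hlam
  have lam_pos : 0 < lam := one_pos.trans one_lt_lam
  obtain ⟨R, hR⟩ := exists_forall_pow_of_affine_step hP hν one_lt_lam hc base step
  set s := D / (lam - 1)
  have s_nonneg : 0 ≤ s := div_nonneg hD (sub_pos.2 one_lt_lam).le
  have tendsto_zero :
      Filter.Tendsto (fun n : ℕ => R * ν * (ν / lam) ^ n) Filter.atTop (nhds 0) := by
    simpa using (tendsto_pow_atTop_nhds_zero_of_lt_one (by positivity)
      ((div_lt_one lam_pos).2 hlam)).const_mul (R * ν)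
  obtain ⟨N, hN⟩ := Filter.eventually_atTop.1 (tendsto_zero.eventually_le_const hε)
  filter_upwards [Filter.eventually_ge_atTop (s + lam ^ N)] with t ht
  obtain ⟨n, pow_le, lt_pow⟩ := exists_nat_pow_near (x := t - s) (y := lam)
    (by linarith [one_le_pow₀ one_lt_lam.le (n := N)]) one_lt_lam
  have N_le : N ≤ n := Nat.lt_succ_iff.1 ((pow_lt_pow_iff_right₀ one_lt_lam).1
    (lt_of_le_of_lt (by linarith) lt_pow))
  refine hP ?_ (hP' (by linarith : t ≤ s + lam ^ (n + 1)) (hR (n + 1)))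
  have mul_pow_le := hN n N_le
  rw [div_pow, ← mul_div_assoc, div_le_iff₀ (by positivity)] at mul_pow_le
  calc R * ν ^ (n + 1) = R * ν * ν ^ n := by ring
    _ ≤ ε * lam ^ n := mul_pow_le
    _ ≤ ε * t := by gcongr; linarith

end AffineRecursion

theorem IsSelfSimilarGrading.eventually_le_boundedPart (hlam : 1 < lam) (hmu : |mu| < lam)
    (hgrlam : IsSelfSimilarGrading p f ψ lam 𝒳lam ℒlam)
    (hgrmu : IsSelfSimilarGrading p f ψ mu 𝒳mu ℒmu) (hψ : Function.Injective ψ)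
    (h𝒳lam : BddBelow {d | 𝒳lam d ≠ ⊥}) (h𝒳mu : Bornology.IsBounded {d | 𝒳mu d ≠ ⊥})
    {G : Set (ℝ × L)} (hG : IsPositiveSpanningSet ℒlam G) {ε : ℝ} (hε : 0 < ε) :
    ∀ᶠ t in Filter.atTop, ∀ d ≤ t, ℒlam d ≤ boundedPart ℒmu (ε * t) := by
  obtain ⟨D, hD⟩ := h𝒳lam
  obtain ⟨E, E_pos, hE⟩ := h𝒳mu.exists_pos_norm_le
  obtain ⟨ν, lt_ν, ν_lt⟩ := exists_between (max_lt hlam hmu)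
  obtain ⟨one_lt_ν, mu_lt_ν⟩ := max_lt_iff.1 lt_ν
  refine eventually_of_affine_step (P := fun t R => ∀ d ≤ t, ℒlam d ≤ boundedPart ℒmu R)
    (c := 2 * E) (D := max 0 (-D)) (fun t R R' hR h d hd => (h d hd).trans (boundedPart_mono hR))
    (fun t t' R ht h d hd => h d (hd.trans ht)) one_lt_ν ν_lt (by positivity) (le_max_left _ _)
    (hG.exists_le_boundedPart hgrmu.isInternal.submodule_iSup_eq_top)
    (fun t R hR h d hd => ?_) hε
  refine (hgrlam.le_boundedPart_of_le (one_pos.trans hlam) hgrmu hψ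
    (fun e he => (neg_le.1 (le_max_right _ _)).trans (hD he)) (fun e he => hE e he) E_pos.le
    hR h hd).trans (boundedPart_mono ?_)
  gcongr

end Growth

/-! ### Straightening -/

section Straightening

variable {k A : Type*} [CommRing k] [Ring A] [Algebra k A]

/-- The elements of `A` whose left multiplication raises the index of the family `M` by `d`. -/
def raising (M : ℝ → Submodule k A) (d : ℝ) : Submodule k A where
  carrier := {a | ∀ m, ∀ u ∈ M m, a * u ∈ M (m + d)}
  zero_mem' m u _ := by simp
  add_mem' ha hb m u hu := by
    rw [add_mul]
    exact add_mem (ha m u hu) (hb m u hu)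
  smul_mem' c a ha m u hu := by
    rw [smul_mul_assoc]
    exact Submodule.smul_mem _ _ (ha m u hu)

/-- The family spanned by the products `b ^ j * u` with `j < n` and `u` in the family `M`, where
`b` has degree `d`. -/
def powExtension (M : ℝ → Submodule k A) (b : A) (d : ℝ) (n : ℕ) (m : ℝ) : Submodule k A :=
  ⨆ (j : ℕ) (_ : j < n), (M (m - j * d)).map (LinearMap.mulLeft k (b ^ j))

variable {M : ℝ → Submodule k A} {b : A} {d : ℝ} {n : ℕ}

theorem pow_mul_mem_powExtension {j : ℕ} (hj : j < n) {m m' : ℝ} {u : A} (hu : u ∈ M m)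
    (hm : m + j * d = m') : b ^ j * u ∈ powExtension M b d n m' := by
  refine Submodule.mem_iSup_of_mem j (Submodule.mem_iSup_of_mem hj ⟨u, ?_, rfl⟩)
  rwa [← hm, add_sub_cancel_right]

theorem powExtension_le {m : ℝ} {W : Submodule k A} :
    powExtension M b d n m ≤ W ↔ ∀ j < n, ∀ u ∈ M (m - j * d), b ^ j * u ∈ W := by
  rw [powExtension, iSup₂_le_iff]
  exact forall₂_congr fun j _ => Submodule.map_le_iff_le_comap

theorem powExtension_mono {n' : ℕ} (h : n ≤ n') (m : ℝ) :
    powExtension M b d n m ≤ powExtension M b d n' m :=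
  powExtension_le.2 fun _ hj _ hu =>
    pow_mul_mem_powExtension (hj.trans_le h) hu (sub_add_cancel _ _)

theorem le_powExtension (hn : 0 < n) (m : ℝ) : M m ≤ powExtension M b d n m := fun u hu => by
  simpa using pow_mul_mem_powExtension (b := b) (d := d) (j := 0) hn hu (by simp)

theorem mem_raising_powExtension_iff {z : A} {e : ℝ} :
    z ∈ raising (powExtension M b d n) e ↔
      ∀ j < n, ∀ m, ∀ u ∈ M m, z * (b ^ j * u) ∈ powExtension M b d n (m + j * d + e) := by
  refine ⟨fun hz j hj m u hu => hz _ _ (pow_mul_mem_powExtension hj hu rfl), fun hz m => ?_⟩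
  suffices powExtension M b d n m ≤
      (powExtension M b d n (m + e)).comap (LinearMap.mulLeft k z) from this
  refine powExtension_le.2 fun j hj u hu => ?_
  simpa using hz j hj _ u hu

theorem mul_mem_powExtension {m : ℝ} {u : A} (hu : u ∈ powExtension M b d n m) :
    b * u ∈ powExtension M b d (n + 1) (m + d) := by
  suffices powExtension M b d n m ≤
      (powExtension M b d (n + 1) (m + d)).comap (LinearMap.mulLeft k b) from this hu
  refine powExtension_le.2 fun j hj v hv => ?_
  rw [Submodule.mem_comap, LinearMap.mulLeft_apply, ← mul_assoc, ← pow_succ']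
  refine pow_mul_mem_powExtension (Nat.succ_lt_succ hj) hv ?_
  push_cast
  ring

variable {K : ℝ → Submodule k A}

/-- Moving `z` to the right past one factor `b` costs the commutator of `z` and `b`, which has
larger degree than `b` and so is covered by `hM`. -/
theorem mul_pow_mul_mem_powExtension (hK : ∀ e ≤ 0, K e = ⊥)
    (hcomm : ∀ e, ∀ z ∈ K e, z * b - b * z ∈ K (e + d)) (hM : ∀ e, d < e → K e ≤ raising M e)
    {e : ℝ} {z : A} (hz : z ∈ K e) (hzM : z ∈ raising M e) (j : ℕ) {m : ℝ} {u : A}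
    (hu : u ∈ M m) : z * (b ^ j * u) ∈ powExtension M b d (j + 1) (m + j * d + e) := by
  induction j generalizing e z with
  | zero => simpa using le_powExtension Nat.one_pos _ (hzM m u hu)
  | succ j ih =>
    have mul_eq : z * (b ^ (j + 1) * u) =
        b * (z * (b ^ j * u)) + (z * b - b * z) * (b ^ j * u) := by
      rw [pow_succ']
      noncomm_ring
    have degree_eq : m + (j + 1 : ℕ) * d + e = m + j * d + e + d := by push_cast; ring
    rw [mul_eq, degree_eq]
    refine add_mem (mul_mem_powExtension (ih hz hzM)) ?_
    rcases le_or_gt e 0 with he | he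
    · rw [hK e he, Submodule.mem_bot] at hz
      simp [hz]
    · have comm_mem := hcomm e z hz
      rw [add_assoc _ e d]
      exact powExtension_mono (Nat.le_succ _) _
        (ih comm_mem (hM _ (lt_add_of_pos_left d he) comm_mem))

theorem mem_raising_powExtension (hK : ∀ e ≤ 0, K e = ⊥)
    (hcomm : ∀ e, ∀ z ∈ K e, z * b - b * z ∈ K (e + d)) (hM : ∀ e, d < e → K e ≤ raising M e)
    {e : ℝ} {z : A} (hz : z ∈ K e) (hzM : z ∈ raising M e) :
    z ∈ raising (powExtension M b d n) e :=
  mem_raising_powExtension_iff.2 fun j hj _ _ hu =>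
    powExtension_mono hj _ (mul_pow_mul_mem_powExtension hK hcomm hM hz hzM j hu)

theorem self_mem_raising_powExtension (hn : 0 < n) (hpow : b ^ n ∈ raising M (n * d)) :
    b ∈ raising (powExtension M b d n) d := by
  refine mem_raising_powExtension_iff.2 fun j hj m u hu => ?_
  rw [← mul_assoc, ← pow_succ', add_assoc, ← add_one_mul, ← Nat.cast_succ]
  rcases (Nat.succ_le_of_lt hj).lt_or_eq with hlt | rfl
  · exact pow_mul_mem_powExtension hlt hu rfl
  · exact le_powExtension hn _ (hpow m u hu)

/-- The component of index `m` of the family `M` lives in the degrees between `-(C + ε * m)` and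
`C + ε * m` for the family `ℬ`, and `1` has index `0`. -/
structure IsTempered (ℬ : ℝ → Submodule k A) (ε : ℝ) (M : ℝ → Submodule k A) : Prop where
  one_mem : 1 ∈ M 0
  exists_le_boundedPart : ∃ C, ∀ m, M m ≤ boundedPart ℬ (C + ε * m)

variable {ℬ : ℝ → Submodule k A} [SetLike.GradedMonoid ℬ] {ε : ℝ}

theorem isTempered_boundedPart : IsTempered ℬ ε fun m => boundedPart ℬ (ε * m) where
  one_mem := one_mem_boundedPart (mul_zero ε).ge
  exists_le_boundedPart := ⟨0, fun m => by rw [zero_add]⟩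

theorem boundedPart_le_raising (d : ℝ) :
    boundedPart ℬ (ε * d) ≤ raising (fun m => boundedPart ℬ (ε * m)) d := fun a ha m u hu => by
  beta_reduce at hu ⊢
  rw [mul_add, add_comm]
  exact mul_mem_boundedPart ha hu

theorem IsTempered.powExtension (hM : IsTempered ℬ ε M) (hℬ : ⨆ e, ℬ e = ⊤) (hε : 0 ≤ ε)
    (hd : 0 ≤ d) (hn : 0 < n) : IsTempered ℬ ε (powExtension M b d n) where
  one_mem := le_powExtension hn 0 hM.one_mem
  exists_le_boundedPart := by
    obtain ⟨C, hC⟩ := hM.exists_le_boundedPart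
    obtain ⟨R, R_nonneg, hR⟩ := exists_subset_boundedPart hℬ (Set.finite_singleton b)
    refine ⟨n * R + C, fun m => powExtension_le.2 fun j hj u hu =>
      boundedPart_mono ?_ (mul_mem_boundedPart (pow_mem_boundedPart (hR rfl) j) (hC _ hu))⟩
    have mul_le : (j : ℝ) * R ≤ n * R := by gcongr
    have : 0 ≤ ε * (j * d) := by positivity
    linarith

variable {G : Set (ℝ × A)} {p : ℕ}

/-- The elements of `s` are adjoined in the order of decreasing degree, so that the commutators and
the `p`-th powers that come up are covered by the elements adjoined before. -/
theorem IsTempered.exists_le_raising (hp : 1 < p) (hG : IsPositiveSpanningSet K G)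
    (hcomm : ∀ d e, ∀ a ∈ K d, ∀ b ∈ K e, a * b - b * a ∈ K (d + e))
    (hpow : ∀ d, ∀ a ∈ K d, a ^ p ∈ K (p * d)) (hℬ : ⨆ e, ℬ e = ⊤) (hε : 0 ≤ ε)
    (s : Finset (ℝ × A)) (hsG : ↑s ⊆ G) {M : ℝ → Submodule k A} (hM : IsTempered ℬ ε M)
    (hs : ∀ q ∈ G, q ∉ s → q.2 ∈ raising M q.1) :
    ∃ M', IsTempered ℬ ε M' ∧ ∀ d, K d ≤ raising M' d := by
  classical
  induction s using Finset.induction_on_max_value (fun q : ℝ × A => q.1) generalizing M with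
  | empty =>
    refine ⟨M, hM, fun d => ?_⟩
    rw [← hG.span_eq d]
    exact Submodule.span_le.2 fun a ha => hs (d, a) ha (Finset.notMem_empty _)
  | insert q s _ hmax ih =>
    rw [Finset.coe_insert, Set.insert_subset_iff] at hsG
    have q_pos := hG.pos q hsG.1
    have hcomm_q (e) (z) (hz : z ∈ K e) := hcomm e _ z hz _ (hG.mem hsG.1)
    have le_raising (e) (he : q.1 < e) : K e ≤ raising M e := by
      rw [← hG.span_eq e]
      refine Submodule.span_le.2 fun a ha => hs (e, a) ha fun hmem => he.not_ge ?_
      rcases Finset.mem_insert.1 hmem with heq | hmem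
      exacts [(congrArg Prod.fst heq).le, hmax _ hmem]
    refine ih hsG.2 (hM.powExtension (b := q.2) (n := p) hℬ hε q_pos.le (zero_lt_one.trans hp))
      fun r hr hrs => ?_
    rcases eq_or_ne r q with rfl | hrq
    · exact self_mem_raising_powExtension (zero_lt_one.trans hp)
        (le_raising _ (lt_mul_of_one_lt_left q_pos (mod_cast hp)) (hpow _ _ (hG.mem hr)))
    · exact mem_raising_powExtension (fun e he => hG.eq_bot he) hcomm_q le_raising (hG.mem hr)
        (hs r hr (Finset.mem_insert.not.2 (not_or.2 ⟨hrq, hrs⟩)))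

theorem exists_isTempered_le_raising (hp : 1 < p) (hG : IsPositiveSpanningSet K G)
    (hcomm : ∀ d e, ∀ a ∈ K d, ∀ b ∈ K e, a * b - b * a ∈ K (d + e))
    (hpow : ∀ d, ∀ a ∈ K d, a ^ p ∈ K (p * d)) (hℬ : ⨆ e, ℬ e = ⊤) (hε : 0 ≤ ε)
    (hK : ∀ᶠ d in Filter.atTop, K d ≤ boundedPart ℬ (ε * d)) :
    ∃ M, IsTempered ℬ ε M ∧ ∀ d, K d ≤ raising M d := by
  obtain ⟨D, hD⟩ := Filter.eventually_atTop.1 hK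
  refine isTempered_boundedPart.exists_le_raising hp hG hcomm hpow hℬ hε (hG.finite D).toFinset
    (fun q hq => ((hG.finite D).mem_toFinset.1 hq).1) fun q hq hqD => ?_
  have D_le : D ≤ q.1 := le_of_not_ge fun hle => hqD ((hG.finite D).mem_toFinset.2 ⟨hq, hle⟩)
  exact boundedPart_le_raising _ (hD _ D_le (hG.mem hq))

end Straightening

namespace Enveloping

variable {k L : Type*} [CommRing k] [LieRing L] [LieAlgebra k L] {p : ℕ} {f : L → L}
  {ℒ ℒ' : ℝ → Submodule k L}

theorem homogeneous_le {M : ℝ → Submodule k (Enveloping k p f)} (one_mem : 1 ∈ M 0)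
    (hM : ∀ d, (ℒ d).map (ι k p f) ≤ raising M d) (m : ℝ) : homogeneous k p f ℒ m ≤ M m := by
  refine Submodule.span_le.2 ?_
  rintro _ ⟨l, hl, rfl, rfl⟩
  induction l with
  | nil => simpa using one_mem
  | cons q l ih =>
    rw [List.forall_mem_cons] at hl
    rw [List.map_cons, List.sum_cons, List.map_cons, List.prod_cons, add_comm]
    exact hM q.1 (Submodule.mem_map_of_mem hl.1) _ _ (ih hl.2)

theorem map_ι_boundedPart_le (r : ℝ) :
    (boundedPart ℒ r).map (ι k p f) ≤ boundedPart (homogeneous k p f ℒ) r :=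
  Submodule.map_le_iff_le_comap.2 <| boundedPart_le.2 fun _ hd _ ha =>
    mem_boundedPart_of_mem hd (ι_mem_homogeneous ha)

theorem exists_homogeneous_le_boundedPart (hp : 1 < p) (hℒ : IsRestrictedGrading p f ℒ)
    (hℒ' : ⨆ d, ℒ' d = ⊤) {G : Set (ℝ × L)} (hG : IsPositiveSpanningSet ℒ G) {ε : ℝ}
    (hε : 0 ≤ ε) (hgrowth : ∀ᶠ d in Filter.atTop, ℒ d ≤ boundedPart ℒ' (ε * d)) :
    ∃ C, ∀ m, homogeneous k p f ℒ m ≤ boundedPart (homogeneous k p f ℒ') (C + ε * m) := by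
  have comm_mem (d e) : ∀ u ∈ (ℒ d).map (ι k p f), ∀ v ∈ (ℒ e).map (ι k p f),
      u * v - v * u ∈ (ℒ (d + e)).map (ι k p f) := by
    rintro _ ⟨a, ha, rfl⟩ _ ⟨b, hb, rfl⟩
    exact ⟨⁅a, b⁆, hℒ.lie_mem d e a ha b hb, isRestrictedHom_ι.map_lie a b⟩
  have pow_mem (d) : ∀ u ∈ (ℒ d).map (ι k p f), u ^ p ∈ (ℒ (p * d)).map (ι k p f) := by
    rintro _ ⟨a, ha, rfl⟩
    exact ⟨f a, hℒ.pMap_mem d a ha, isRestrictedHom_ι.map_pMap a⟩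
  obtain ⟨M, hM, le_raising⟩ := exists_isTempered_le_raising (ℬ := homogeneous k p f ℒ') hp
    (hG.map (ι k p f)) comm_mem pow_mem (iSup_homogeneous hℒ') hε
    (hgrowth.mono fun d hd => (Submodule.map_mono hd).trans (map_ι_boundedPart_le _))
  obtain ⟨C, hC⟩ := hM.exists_le_boundedPart
  exact ⟨C, fun m => (homogeneous_le hM.one_mem le_raising m).trans (hC m)⟩

end Enveloping

theorem mainTheorem11_general {k X L : Type*} [CommRing k] {p : ℕ} [Fact p.Prime] [CharP k p]
    [CommRing X] [Algebra k X] [LieRing L] [LieAlgebra k L]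
    (f : L → L) (hf : IsPMap k p f) (ψ : L →ₗ⁅k⁆ Wreath k X L) (hψ : Function.Injective ψ)
    (lam mu : ℝ) (hlam : 1 < lam) (hmu : |mu| < lam)
    (𝒳lam 𝒳mu : ℝ → Submodule k X) (ℒlam ℒmu : ℝ → Submodule k L)
    (h𝒳lam : BddBelow {d | 𝒳lam d ≠ ⊥}) (h𝒳mu : Bornology.IsBounded {d | 𝒳mu d ≠ ⊥})
    (hgrlam : IsSelfSimilarGrading p f ψ lam 𝒳lam ℒlam)
    (hgrmu : IsSelfSimilarGrading p f ψ mu 𝒳mu ℒmu)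
    (hgen : ∃ S : Set L, S.Finite ∧ (∀ s ∈ S, ∃ d : ℝ, 0 < d ∧ s ∈ ℒlam d) ∧
      GeneratesRestricted k f S) :
    DirectSum.IsInternal (Enveloping.signPart k p f ℒmu) ∧
    (1 : Enveloping k p f) ∈ Enveloping.signPart k p f ℒmu 0 ∧
    (∀ (s : SignType) (u v : Enveloping k p f), u ∈ Enveloping.signPart k p f ℒmu s →
      v ∈ Enveloping.signPart k p f ℒmu s → u * v ∈ Enveloping.signPart k p f ℒmu s) ∧
    IsLocallyNilpotent k (Enveloping.signPart k p f ℒmu 1 : Set (Enveloping k p f)) ∧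
    IsLocallyNilpotent k (Enveloping.signPart k p f ℒmu (-1) : Set (Enveloping k p f)) ∧
    (∀ (d : ℝ) (u : Enveloping k p f), d ≠ 0 → u ∈ Enveloping.homogeneous k p f ℒmu d →
      IsNilpotent u) := by
  have hℒlam := hgrlam.isRestrictedGrading
  have hℒmu := hgrmu.isRestrictedGrading
  have iSup_ℒmu := hℒmu.isInternal.submodule_iSup_eq_top
  obtain ⟨S, S_finite, hS, S_generates⟩ := hgen
  obtain ⟨G, hG⟩ := exists_isPositiveSpanningSet hf hℒlam S_finite hS S_generates
  have growth (ε : ℝ) (hε : 0 < ε) : ∃ C, ∀ m, Enveloping.homogeneous k p f ℒlam m ≤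
      boundedPart (Enveloping.homogeneous k p f ℒmu) (C + ε * m) :=
    Enveloping.exists_homogeneous_le_boundedPart (Fact.out (p := p.Prime)).one_lt hℒlam
      iSup_ℒmu hG hε.le ((IsSelfSimilarGrading.eventually_le_boundedPart hlam hmu hgrlam hgrmu hψ
        h𝒳lam h𝒳mu hG hε).mono fun d hd => hd d le_rfl)
  have isLocallyNilpotent (s : SignType) (hs : s ≠ 0) :
      IsLocallyNilpotent k (Enveloping.signPart k p f ℒmu s : Set (Enveloping k p f)) :=
    isLocallyNilpotent_gradedPart_sign
      (Enveloping.iSup_homogeneous hℒlam.isInternal.submodule_iSup_eq_top)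
      (Enveloping.isInternal_homogeneous hf hℒmu).submodule_iSupIndep growth hs
  refine ⟨Enveloping.isInternal_signPart hf hℒmu, Enveloping.one_mem_signPart,
    fun s u v => Enveloping.mul_mem_signPart, isLocallyNilpotent 1 (by decide),
    isLocallyNilpotent (-1) (by decide), fun d u hd hu => ?_⟩
  exact (isLocallyNilpotent _ (sign_ne_zero.2 hd)).isNilpotent
    (Enveloping.homogeneous_le_signPart d hu)

end SelfSimilarLie

end

open SelfSimilarLie in
theorem mainTheorem11 {k X L : Type*} [CommRing k] [IsDomain k] {p : ℕ} [Fact p.Prime] [CharP k p]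
    [CommRing X] [Algebra k X] [Module.Free k X] [Module.Finite k X]
    [LieRing L] [LieAlgebra k L]
    (f : L → L) (hf : IsPMap k p f)
    (ψ : L →ₗ⁅k⁆ Wreath k X L) (hψ : PreservesPMap p f ψ) (hfaithful : IsFaithful ψ)
    (lam mu : ℝ) (hmu : 1 < |mu|) (hlam : |mu| < lam)
    (𝒳lam 𝒳mu : ℝ → Submodule k X) (ℒlam ℒmu : ℝ → Submodule k L)
    (hgrlam : IsSelfSimilarGrading p f ψ lam 𝒳lam ℒlam)
    (hgrmu : IsSelfSimilarGrading p f ψ mu 𝒳mu ℒmu)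
    (hgen : ∃ S : Finset L, (∀ s ∈ S, ∃ d : ℝ, 0 < d ∧ s ∈ ℒlam d) ∧
      GeneratesRestricted k f (S : Set L)) :
    DirectSum.IsInternal (Enveloping.signPart k p f ℒmu) ∧
    (1 : Enveloping k p f) ∈ Enveloping.signPart k p f ℒmu 0 ∧
    (∀ (s : SignType) (u v : Enveloping k p f), u ∈ Enveloping.signPart k p f ℒmu s →
      v ∈ Enveloping.signPart k p f ℒmu s → u * v ∈ Enveloping.signPart k p f ℒmu s) ∧
    IsLocallyNilpotent k (Enveloping.signPart k p f ℒmu 1 : Set (Enveloping k p f)) ∧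
    IsLocallyNilpotent k (Enveloping.signPart k p f ℒmu (-1) : Set (Enveloping k p f)) ∧
    (∀ (d : ℝ) (u : Enveloping k p f), d ≠ 0 → u ∈ Enveloping.homogeneous k p f ℒmu d →
      IsNilpotent u) := by
  obtain ⟨S, hS, S_generates⟩ := hgen
  exact mainTheorem11_general f hf ψ hfaithful.injective lam mu (hmu.trans hlam) hlam
    𝒳lam 𝒳mu ℒlam ℒmu
    (finite_setOf_ne_bot hgrlam.alphabet_isInternal.submodule_iSupIndep
      hgrlam.alphabet_isInternal.submodule_iSup_eq_top).bddBelow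
    (finite_setOf_ne_bot hgrmu.alphabet_isInternal.submodule_iSupIndep
      hgrmu.alphabet_isInternal.submodule_iSup_eq_top).isBounded
    hgrlam hgrmu ⟨S, S.finite_toSet, hS, S_generates⟩
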